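/- Let $F$ be an algebraically closed field of characteristic $p>3$, let $n\ge 2$, $d=\tfrac12 n(n-1)$, and let $\mathfrak g=\mathfrak g_{\bar 0}\oplus\mathfrak g_{\bar 1}$ be the Lie superalgebra $\mathfrak p(n)$ of block matrices $\begin{pmatrix}a&b\\c&-a^t\end{pmatrix}$, where $a,b,c$ are $n\times n$ matrices over $F$, $b$ is symmetric and $c$ is skew-symmetric. Here $\mathfrak g_{\bar 0}$ is given by $b=c=0$, and $\mathfrak g_{\bar 1}$ by $a=0$; let $\mathfrak g_{1}$ be the subspace $a=c=0$. Let $u(\mathfrak g)$ be the restricted enveloping superalgebra, i.e. the quotient of $U(\mathfrak g)$ by the ideal generated by all $x^p-x^{[p]}$ with $x\in\mathfrak g_{\bar 0}$, where $x^{[p]}$ is the $p$-th power of the matrix $x$. Let $\bar{\mathfrak u}=u(\mathfrak g)/I$, where $I$ is the two-sided ideal generated by the products of $k$ elements of $\mathfrak g_1$, for all $k>d$. The group $G=GL_n(F)$ acts on $\mathfrak g$ by conjugation with $\mathrm{diag}(g,(g^{-1})^t)$, and hence on $\bar{\mathfrak u}$ by algebra automorphisms; let $T\subset G$ be the diagonal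 torus. Put $$\mathcal Z=\{z\in\bar{\mathfrak u}_{\bar 0}\mid gz=z\ \text{for all}\ g\in G,\ \ [z,\mathfrak g_{\bar 1}]=0\}.$$ Let $\mathfrak h\subset\mathfrak g_{\bar 0}$ be the diagonal matrices, with basis $h_i=e_{ii}-e_{n+i,n+i}$ $(1\le i\le n)$, so that $u(\mathfrak h)=F[h_1,\dots,h_n]/(h_i^p-h_i\mid 1\le i\le n)$. Let $\mathfrak n^+\subset\mathfrak g$ be the subspace of matrices with $c=0$ and $a$ strictly upper triangular, and let $\mathfrak l=\bar{\mathfrak u}\,\mathfrak n^+\cap\bar{\mathfrak u}^T$. Let $\rho\in\mathfrak h^*$ be given by $\rho(h_i)=-i$, and let $W=S_n$ act on $\mathfrak h^*$ by permuting the coordinates $\mu_i=\mu(h_i)$. The dot action of $W$ on $\mathfrak h^*$ is $w\cdot\mu=w(\mu+\rho)-\rho$; that on polynomial functions, $(w\cdot f)(\mu)=f(w^{-1}\cdot\mu)$, induces a dot action on $u(\mathfrak h)$, with invariants $u(\mathfrak h)^{W\cdot}$. Let $\Theta\in u(\mathfrak h)$ be the image of the polynomial function $$\Theta(\mu)=\prod_{i\ne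 j}\bigl((h_i-h_j)(\mu+\rho)-1\bigr),$$ the product being over ordered pairs. Assume $p>2d=n(n-1)$. Then the canonical map $u(\mathfrak h)\to\bar{\mathfrak u}$ is injective and $\bar{\mathfrak u}^T=u(\mathfrak h)\oplus\mathfrak l$, so that the Harish-Chandra projection $h:\bar{\mathfrak u}^T\to u(\mathfrak h)$ with kernel $\mathfrak l$ is defined, and $$h(\mathcal Z)\subseteq\Theta\,u(\mathfrak h)^{W\cdot}+F .$$ -/

import Mathlib

/-! The periplectic Lie superalgebra `p(n)`, its restricted enveloping superalgebra, the quotient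
`ū`, the central subalgebra `𝒵` and the Harish-Chandra projection. -/

namespace Periplectic

section LieSuperalgebra

/-- The `2n × 2n` matrices over `F`, in `n × n` blocks. -/
abbrev Mat (n : ℕ) (F : Type*) := Matrix (Fin n ⊕ Fin n) (Fin n ⊕ Fin n) F

/-- The underlying space of `p(n)`: block matrices `(a, b; c, -aᵀ)` with `b` symmetric and
`c` skew-symmetric. -/
def pn (n : ℕ) (F : Type*) [Field F] : Submodule F (Mat n F) where
  carrier := {X | X.toBlocks₂₂ = -X.toBlocks₁₁.transpose ∧
    X.toBlocks₁₂.transpose = X.toBlocks₁₂ ∧ X.toBlocks₂₁.transpose = -X.toBlocks₂₁}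
  zero_mem' := by
    refine ⟨?_, ?_, ?_⟩ <;> ext i j <;>
      simp [Matrix.toBlocks₁₁, Matrix.toBlocks₁₂, Matrix.toBlocks₂₁, Matrix.toBlocks₂₂]
  add_mem' := by
    rintro X Y ⟨h1, h2, h3⟩ ⟨k1, k2, k3⟩
    refine ⟨?_, ?_, ?_⟩ <;> ext i j
    · have := congrFun₂ h1 i j; have := congrFun₂ k1 i j
      simp_all [Matrix.toBlocks₁₁, Matrix.toBlocks₂₂]; ring
    · have := congrFun₂ h2 i j; have := congrFun₂ k2 i j
      simp_all [Matrix.toBlocks₁₂]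
    · have := congrFun₂ h3 i j; have := congrFun₂ k3 i j
      simp_all [Matrix.toBlocks₂₁]; ring
  smul_mem' := by
    rintro c X ⟨h1, h2, h3⟩
    refine ⟨?_, ?_, ?_⟩ <;> ext i j
    · have := congrFun₂ h1 i j
      simp_all [Matrix.toBlocks₁₁, Matrix.toBlocks₂₂]
    · have := congrFun₂ h2 i j
      simp_all [Matrix.toBlocks₁₂]
    · have := congrFun₂ h3 i j
      simp_all [Matrix.toBlocks₂₁]

variable {n : ℕ} {F : Type*} [Field F]

theorem mem_pn_fromBlocks {A B C D : Matrix (Fin n) (Fin n) F} :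
    Matrix.fromBlocks A B C D ∈ pn n F ↔
      D = -A.transpose ∧ B.transpose = B ∧ C.transpose = -C := Iff.rfl

variable (n F) in
/-- The even part `𝔤_0̄`: matrices with `b = c = 0`. -/
def even : Submodule F (pn n F) where
  carrier := {x | (x : Mat n F).toBlocks₁₂ = 0 ∧ (x : Mat n F).toBlocks₂₁ = 0}
  zero_mem' := ⟨rfl, rfl⟩
  add_mem' := by
    rintro x y ⟨h1, h2⟩ ⟨k1, k2⟩
    exact ⟨(congrArg₂ (· + ·) h1 k1).trans (add_zero 0),
      (congrArg₂ (· + ·) h2 k2).trans (add_zero 0)⟩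
  smul_mem' := by
    rintro c x ⟨h1, h2⟩
    exact ⟨(congrArg (c • ·) h1).trans (smul_zero c), (congrArg (c • ·) h2).trans (smul_zero c)⟩

variable (n F) in
/-- The odd part `𝔤_1̄ = 𝔤_{-1} ⊕ 𝔤_1`: matrices with `a = 0`. -/
def odd : Submodule F (pn n F) where
  carrier := {x | (x : Mat n F).toBlocks₁₁ = 0 ∧ (x : Mat n F).toBlocks₂₂ = 0}
  zero_mem' := ⟨rfl, rfl⟩
  add_mem' := by
    rintro x y ⟨h1, h2⟩ ⟨k1, k2⟩
    exact ⟨(congrArg₂ (· + ·) h1 k1).trans (add_zero 0),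
      (congrArg₂ (· + ·) h2 k2).trans (add_zero 0)⟩
  smul_mem' := by
    rintro c x ⟨h1, h2⟩
    exact ⟨(congrArg (c • ·) h1).trans (smul_zero c), (congrArg (c • ·) h2).trans (smul_zero c)⟩

variable (n F) in
/-- The component `𝔤_1` of the `ℤ`-grading: matrices with `a = 0` and `c = 0`. -/
def degOne : Submodule F (pn n F) where
  carrier := {x | x ∈ odd n F ∧ (x : Mat n F).toBlocks₂₁ = 0}
  zero_mem' := ⟨(odd n F).zero_mem, rfl⟩
  add_mem' := by
    rintro x y ⟨h1, h2⟩ ⟨k1, k2⟩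
    exact ⟨(odd n F).add_mem h1 k1, (congrArg₂ (· + ·) h2 k2).trans (add_zero 0)⟩
  smul_mem' := by
    rintro c x ⟨h1, h2⟩
    exact ⟨(odd n F).smul_mem c h1, (congrArg (c • ·) h2).trans (smul_zero c)⟩

variable (n F) in
/-- `𝔫⁺ = 𝔫₀⁺ ⊕ 𝔤_1`, spanned by the root vectors of the positive roots `ε_i - ε_j` (`i < j`)
and `ε_i + ε_j` (`i ≤ j`): matrices with `c = 0` and `a` strictly upper triangular. -/
def nPlus : Submodule F (pn n F) where
  carrier := {x | (x : Mat n F).toBlocks₂₁ = 0 ∧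
    ∀ i j : Fin n, j ≤ i → (x : Mat n F) (Sum.inl i) (Sum.inl j) = 0}
  zero_mem' := ⟨rfl, fun _ _ _ => rfl⟩
  add_mem' := by
    rintro x y ⟨h1, h2⟩ ⟨k1, k2⟩
    refine ⟨(congrArg₂ (· + ·) h1 k1).trans (add_zero 0), fun i j hij => ?_⟩
    simp [h2 i j hij, k2 i j hij]
  smul_mem' := by
    rintro c x ⟨h1, h2⟩
    refine ⟨(congrArg (c • ·) h1).trans (smul_zero c), fun i j hij => ?_⟩
    simp [h2 i j hij]

/-- If one of two homogeneous elements is even, their superbracket is the commutator. -/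
theorem comm_mem (x y : pn n F) (hx : x ∈ even n F) (hy : y ∈ even n F ∨ y ∈ odd n F) :
    (x : Mat n F) * y - y * x ∈ pn n F := by
  obtain ⟨X, hX⟩ := x
  obtain ⟨Y, hY⟩ := y
  obtain ⟨A, B, C, D, rfl⟩ : ∃ A B C D, X = Matrix.fromBlocks A B C D :=
    ⟨_, _, _, _, (Matrix.fromBlocks_toBlocks X).symm⟩
  obtain ⟨A', B', C', D', rfl⟩ : ∃ A B C D, Y = Matrix.fromBlocks A B C D :=
    ⟨_, _, _, _, (Matrix.fromBlocks_toBlocks Y).symm⟩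
  obtain ⟨h1, h2, h3⟩ := mem_pn_fromBlocks.1 hX
  obtain ⟨k1, k2, k3⟩ := mem_pn_fromBlocks.1 hY
  obtain ⟨e1, e2⟩ : B = 0 ∧ C = 0 := hx
  subst h1 k1 e1 e2
  simp only [Matrix.fromBlocks_multiply, sub_eq_add_neg, Matrix.fromBlocks_neg,
    Matrix.fromBlocks_add]
  rw [mem_pn_fromBlocks]
  refine ⟨?_, ?_, ?_⟩
  · simp
  · simp [k2, add_comm]
  · simp [k3]

/-- The superbracket of two odd elements is the anticommutator. -/
theorem anticomm_mem (x y : pn n F) (hx : x ∈ odd n F) (hy : y ∈ odd n F) :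
    (x : Mat n F) * y + y * x ∈ pn n F := by
  obtain ⟨X, hX⟩ := x
  obtain ⟨Y, hY⟩ := y
  obtain ⟨A, B, C, D, rfl⟩ : ∃ A B C D, X = Matrix.fromBlocks A B C D :=
    ⟨_, _, _, _, (Matrix.fromBlocks_toBlocks X).symm⟩
  obtain ⟨A', B', C', D', rfl⟩ : ∃ A B C D, Y = Matrix.fromBlocks A B C D :=
    ⟨_, _, _, _, (Matrix.fromBlocks_toBlocks Y).symm⟩
  obtain ⟨h1, h2, h3⟩ := mem_pn_fromBlocks.1 hX
  obtain ⟨k1, k2, k3⟩ := mem_pn_fromBlocks.1 hY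
  obtain ⟨rfl, e2⟩ : A = 0 ∧ D = 0 := hx
  obtain ⟨rfl, e4⟩ : A' = 0 ∧ D' = 0 := hy
  subst e2 e4
  simp only [Matrix.fromBlocks_multiply, Matrix.fromBlocks_add]
  rw [mem_pn_fromBlocks]
  refine ⟨?_, ?_, ?_⟩
  · simp [h2, h3, k2, k3]
  · simp
  · simp

/-- `𝔤_0̄` is closed under `p`-th powers of matrices. -/
theorem pow_mem (p : ℕ) [Fact p.Prime] [CharP F p] (x : pn n F) (hx : x ∈ even n F) :
    (x : Mat n F) ^ p ∈ pn n F := by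
  obtain ⟨X, hX⟩ := x
  obtain ⟨A, B, C, D, rfl⟩ : ∃ A B C D, X = Matrix.fromBlocks A B C D :=
    ⟨_, _, _, _, (Matrix.fromBlocks_toBlocks X).symm⟩
  obtain ⟨h1, h2, h3⟩ := mem_pn_fromBlocks.1 hX
  obtain ⟨e1, e2⟩ : B = 0 ∧ C = 0 := hx
  subst h1 e1 e2
  have hpow : ∀ k : ℕ, (Matrix.fromBlocks A 0 0 (-A.transpose)) ^ k =
      Matrix.fromBlocks (A ^ k) 0 0 ((-A.transpose) ^ k) := by
    intro k
    induction k with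
    | zero => simp
    | succ k ih => simp [pow_succ, ih, Matrix.fromBlocks_multiply]
  have hneg : (-A.transpose) ^ p = -(A ^ p).transpose := by
    rcases (Fact.out : p.Prime).eq_two_or_odd' with rfl | hodd
    · rw [neg_sq, Matrix.transpose_pow]
      have : CharP (Matrix (Fin n) (Fin n) F) 2 ∨ IsEmpty (Fin n) := by
        rcases isEmpty_or_nonempty (Fin n) with h | h
        · exact Or.inr h
        · exact Or.inl inferInstance
      ext i j
      simp [CharTwo.neg_eq]
    · rw [hodd.neg_pow, Matrix.transpose_pow]
  show (Matrix.fromBlocks A 0 0 (-A.transpose)) ^ p ∈ pn n F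
  rw [hpow, mem_pn_fromBlocks]
  exact ⟨hneg, by simp, by simp⟩

end LieSuperalgebra

section Enveloping

variable (n : ℕ) (F : Type*) [Field F]

/-- The defining relations of the universal enveloping superalgebra:
`x y - (-1)^{|x||y|} y x = [x, y]` for homogeneous `x`, `y`. -/
inductive EnvRel : TensorAlgebra F (pn n F) → TensorAlgebra F (pn n F) → Prop
  | comm (x y : pn n F) (hx : x ∈ even n F) (hy : y ∈ even n F ∨ y ∈ odd n F) :
      EnvRel (TensorAlgebra.ι F x * TensorAlgebra.ι F y - TensorAlgebra.ι F y * TensorAlgebra.ι F x)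
        (TensorAlgebra.ι F ⟨(x : Mat n F) * y - y * x, comm_mem x y hx hy⟩)
  | anticomm (x y : pn n F) (hx : x ∈ odd n F) (hy : y ∈ odd n F) :
      EnvRel (TensorAlgebra.ι F x * TensorAlgebra.ι F y + TensorAlgebra.ι F y * TensorAlgebra.ι F x)
        (TensorAlgebra.ι F ⟨(x : Mat n F) * y + y * x, anticomm_mem x y hx hy⟩)

/-- The universal enveloping superalgebra `U(𝔤)`. -/
def U := RingQuot (EnvRel n F)

noncomputable instance : Ring (U n F) := inferInstanceAs (Ring (RingQuot (EnvRel n F)))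

noncomputable instance : Algebra F (U n F) :=
  inferInstanceAs (Algebra F (RingQuot (EnvRel n F)))

/-- The quotient map onto `U(𝔤)`. -/
noncomputable def mkU : TensorAlgebra F (pn n F) →ₐ[F] U n F := RingQuot.mkAlgHom F (EnvRel n F)

variable {n F} in
theorem mkU_rel {a b : TensorAlgebra F (pn n F)} (h : EnvRel n F a b) : mkU n F a = mkU n F b :=
  RingQuot.mkAlgHom_rel F h

/-- The canonical map `𝔤 → U(𝔤)`. -/
noncomputable def ιU : pn n F →ₗ[F] U n F :=
  (mkU n F).toLinearMap ∘ₗ TensorAlgebra.ι F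

variable (p : ℕ) [Fact p.Prime] [CharP F p]

/-- The relations `x ^ p = x^{[p]}`, `x ∈ 𝔤_0̄`, where `x^{[p]}` is the `p`-th power of the
matrix `x`. -/
inductive ResRel : U n F → U n F → Prop
  | pow (x : pn n F) (hx : x ∈ even n F) :
      ResRel (ιU n F x ^ p) (ιU n F ⟨(x : Mat n F) ^ p, pow_mem p x hx⟩)

/-- The restricted enveloping superalgebra `u(𝔤)`. -/
def u := RingQuot (ResRel n F p)

noncomputable instance : Ring (u n F p) := inferInstanceAs (Ring (RingQuot (ResRel n F p)))

noncomputable instance : Algebra F (u n F p) :=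
  inferInstanceAs (Algebra F (RingQuot (ResRel n F p)))

/-- The quotient map `U(𝔤) → u(𝔤)`. -/
noncomputable def mku : U n F →ₐ[F] u n F p := RingQuot.mkAlgHom F (ResRel n F p)

variable {n F} in
theorem mku_rel {a b : U n F} (h : ResRel n F p a b) : mku n F p a = mku n F p b :=
  RingQuot.mkAlgHom_rel F h

/-- The canonical map `𝔤 → u(𝔤)`. -/
noncomputable def ιu : pn n F →ₗ[F] u n F p :=
  (mku n F p).toLinearMap ∘ₗ ιU n F

/-- The relations killing all products of `k` elements of `𝔤_1` for
`k > d = n (n - 1) / 2 = dim 𝔤_{-1}`. -/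
inductive NilRel : u n F p → u n F p → Prop
  | prod (l : List (pn n F)) (hl : ∀ x ∈ l, x ∈ degOne n F) (hd : n * (n - 1) / 2 < l.length) :
      NilRel (l.map (ιu n F p)).prod 0

/-- The quotient superalgebra `ū = u(𝔤) / I`, with `I` the two-sided ideal generated by
`⋀^k 𝔤_1` for `k > d`. -/
def ubar := RingQuot (NilRel n F p)

noncomputable instance : Ring (ubar n F p) := inferInstanceAs (Ring (RingQuot (NilRel n F p)))

noncomputable instance : Algebra F (ubar n F p) :=
  inferInstanceAs (Algebra F (RingQuot (NilRel n F p)))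

/-- The quotient map `u(𝔤) → ū`. -/
noncomputable def mkubar : u n F p →ₐ[F] ubar n F p := RingQuot.mkAlgHom F (NilRel n F p)

variable {n F} in
theorem mkubar_rel {a b : u n F p} (h : NilRel n F p a b) : mkubar n F p a = mkubar n F p b :=
  RingQuot.mkAlgHom_rel F h

/-- The canonical map `𝔤 → ū`. -/
noncomputable def ι : pn n F →ₗ[F] ubar n F p :=
  (mkubar n F p).toLinearMap ∘ₗ ιu n F p

/-- The even part `ū_0̄`, spanned by the products of elements of `𝔤_0̄ ∪ 𝔤_1̄` with an even number
of factors from `𝔤_1̄`; in other words generated by `𝔤_0̄` and the products of two odd elements. -/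
noncomputable def ubarEven : Subalgebra F (ubar n F p) :=
  Algebra.adjoin F ({a | ∃ x ∈ even n F, ι n F p x = a} ∪
    {a | ∃ x ∈ odd n F, ∃ y ∈ odd n F, ι n F p x * ι n F p y = a})

end Enveloping

section GroupAction

variable {n : ℕ} {F : Type*} [Field F]

/-- The embedding `GL_n → GL_{2n}`, `a ↦ diag(a, (a⁻¹)ᵀ)`. -/
def rhoGL (g : GL (Fin n) F) : (Mat n F)ˣ where
  val := Matrix.fromBlocks (g : Matrix (Fin n) (Fin n) F) 0 0
    ((g⁻¹ : GL (Fin n) F) : Matrix (Fin n) (Fin n) F).transpose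
  inv := Matrix.fromBlocks ((g⁻¹ : GL (Fin n) F) : Matrix (Fin n) (Fin n) F) 0 0
    (g : Matrix (Fin n) (Fin n) F).transpose
  val_inv := by
    rw [Matrix.fromBlocks_multiply]
    simp [← Matrix.transpose_mul, ← Units.val_mul, -Matrix.coe_units_inv]
  inv_val := by
    rw [Matrix.fromBlocks_multiply]
    simp [← Matrix.transpose_mul, ← Units.val_mul, -Matrix.coe_units_inv]

theorem conj_fromBlocks (g : GL (Fin n) F) (A B C D : Matrix (Fin n) (Fin n) F) :
    (rhoGL g : Mat n F) * Matrix.fromBlocks A B C D * ((rhoGL g)⁻¹ : (Mat n F)ˣ) =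
      Matrix.fromBlocks
        (g.val * A * g.inv) (g.val * B * g.val.transpose)
        (g.inv.transpose * C * g.inv) (g.inv.transpose * D * g.val.transpose) := by
  show Matrix.fromBlocks g.val 0 0 g.inv.transpose * Matrix.fromBlocks A B C D *
    Matrix.fromBlocks g.inv 0 0 g.val.transpose = _
  simp only [Matrix.fromBlocks_multiply]
  simp

theorem conj_mem (g : GL (Fin n) F) (x : pn n F) :
    (rhoGL g : Mat n F) * x * ((rhoGL g)⁻¹ : (Mat n F)ˣ) ∈ pn n F := by
  obtain ⟨X, hX⟩ := x
  obtain ⟨A, B, C, D, rfl⟩ : ∃ A B C D, X = Matrix.fromBlocks A B C D :=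
    ⟨_, _, _, _, (Matrix.fromBlocks_toBlocks X).symm⟩
  obtain ⟨h1, h2, h3⟩ := mem_pn_fromBlocks.1 hX
  rw [conj_fromBlocks, mem_pn_fromBlocks]
  subst h1
  refine ⟨?_, ?_, ?_⟩
  · simp only [Matrix.transpose_mul, mul_neg, neg_mul, mul_assoc]
  · simp only [Matrix.transpose_mul, Matrix.transpose_transpose, h2, mul_assoc]
  · simp only [Matrix.transpose_mul, Matrix.transpose_transpose, h3, mul_neg, neg_mul, mul_assoc]

/-- The action of `G = GL_n(F)` on `𝔤`: `x ↦ ρ(g) x ρ(g)⁻¹`. -/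
def Ad (g : GL (Fin n) F) : pn n F →ₗ[F] pn n F where
  toFun x := ⟨(rhoGL g : Mat n F) * x * ((rhoGL g)⁻¹ : (Mat n F)ˣ), conj_mem g x⟩
  map_add' x y := by ext1; simp [mul_add, add_mul]
  map_smul' c x := by ext1; simp

theorem Ad_even (g : GL (Fin n) F) {x : pn n F} (hx : x ∈ even n F) : Ad g x ∈ even n F := by
  obtain ⟨X, hX⟩ := x
  obtain ⟨A, B, C, D, rfl⟩ : ∃ A B C D, X = Matrix.fromBlocks A B C D :=
    ⟨_, _, _, _, (Matrix.fromBlocks_toBlocks X).symm⟩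
  obtain ⟨rfl, rfl⟩ : B = 0 ∧ C = 0 := hx
  show ((rhoGL g : Mat n F) * _ * ((rhoGL g)⁻¹ : (Mat n F)ˣ) : Mat n F).toBlocks₁₂ = 0 ∧
    ((rhoGL g : Mat n F) * _ * ((rhoGL g)⁻¹ : (Mat n F)ˣ) : Mat n F).toBlocks₂₁ = 0
  rw [conj_fromBlocks]; simp

theorem Ad_odd (g : GL (Fin n) F) {x : pn n F} (hx : x ∈ odd n F) : Ad g x ∈ odd n F := by
  obtain ⟨X, hX⟩ := x
  obtain ⟨A, B, C, D, rfl⟩ : ∃ A B C D, X = Matrix.fromBlocks A B C D :=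
    ⟨_, _, _, _, (Matrix.fromBlocks_toBlocks X).symm⟩
  obtain ⟨rfl, rfl⟩ : A = 0 ∧ D = 0 := hx
  show ((rhoGL g : Mat n F) * _ * ((rhoGL g)⁻¹ : (Mat n F)ˣ) : Mat n F).toBlocks₁₁ = 0 ∧
    ((rhoGL g : Mat n F) * _ * ((rhoGL g)⁻¹ : (Mat n F)ˣ) : Mat n F).toBlocks₂₂ = 0
  rw [conj_fromBlocks]; simp

theorem Ad_degOne (g : GL (Fin n) F) {x : pn n F} (hx : x ∈ degOne n F) :
    Ad g x ∈ degOne n F := by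
  refine ⟨Ad_odd g hx.1, ?_⟩
  obtain ⟨X, hX⟩ := x
  obtain ⟨A, B, C, D, rfl⟩ : ∃ A B C D, X = Matrix.fromBlocks A B C D :=
    ⟨_, _, _, _, (Matrix.fromBlocks_toBlocks X).symm⟩
  obtain rfl : C = 0 := hx.2
  show ((rhoGL g : Mat n F) * _ * ((rhoGL g)⁻¹ : (Mat n F)ˣ) : Mat n F).toBlocks₂₁ = 0
  rw [conj_fromBlocks]; simp

/-- The action of `G` on `U(𝔤)` by algebra homomorphisms extending `Ad`. -/
noncomputable def actU (g : GL (Fin n) F) : U n F →ₐ[F] U n F :=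
  RingQuot.liftAlgHom F ⟨TensorAlgebra.lift F (ιU n F ∘ₗ Ad g), by
    intro a b hab
    cases hab with
    | comm x y hx hy =>
      have := mkU_rel (EnvRel.comm (Ad g x) (Ad g y) (Ad_even g hx)
        (hy.imp (Ad_even g) (Ad_odd g)))
      simp only [map_sub, map_mul, TensorAlgebra.lift_ι_apply] at this ⊢
      refine this.trans (congrArg (ιU n F) (Subtype.ext ?_))
      simp [Ad, mul_sub, sub_mul, mul_assoc]
    | anticomm x y hx hy =>
      have := mkU_rel (EnvRel.anticomm (Ad g x) (Ad g y) (Ad_odd g hx)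
        (Ad_odd g hy))
      simp only [map_add, map_mul, TensorAlgebra.lift_ι_apply] at this ⊢
      refine this.trans (congrArg (ιU n F) (Subtype.ext ?_))
      simp [Ad, mul_add, add_mul, mul_assoc]⟩

theorem actU_ι (g : GL (Fin n) F) (x : pn n F) : actU g (ιU n F x) = ιU n F (Ad g x) := by
  refine (RingQuot.liftAlgHom_mkAlgHom_apply F _ _ _).trans ?_
  rw [TensorAlgebra.lift_ι_apply]
  rfl

variable (p : ℕ) [Fact p.Prime] [CharP F p]

/-- The action of `G` on `u(𝔤)`. -/
noncomputable def actu (g : GL (Fin n) F) : u n F p →ₐ[F] u n F p :=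
  RingQuot.liftAlgHom F ⟨(mku n F p).comp (actU g), by
    intro a b hab
    cases hab with
    | pow x hx =>
      have := mku_rel p (ResRel.pow (p := p) (Ad g x) (Ad_even g hx))
      simp only [AlgHom.comp_apply, map_pow, actU_ι] at this ⊢
      refine this.trans (congrArg (ιu n F p) (Subtype.ext ?_))
      exact Units.conj_pow (rhoGL g) (x : Mat n F) p⟩

theorem actu_ι (g : GL (Fin n) F) (x : pn n F) : actu p g (ιu n F p x) = ιu n F p (Ad g x) := by
  refine (RingQuot.liftAlgHom_mkAlgHom_apply F _ _ _).trans ?_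
  rw [AlgHom.comp_apply, actU_ι]
  rfl

/-- The action of `G` on `ū`. -/
noncomputable def act (g : GL (Fin n) F) : ubar n F p →ₐ[F] ubar n F p :=
  RingQuot.liftAlgHom F ⟨(mkubar n F p).comp (actu p g), by
    intro a b hab
    cases hab with
    | prod l hl hd =>
      have := mkubar_rel p (NilRel.prod (p := p) (l.map (Ad g))
        (by
          intro x hx
          obtain ⟨y, hy, rfl⟩ := List.mem_map.1 hx
          exact Ad_degOne g (hl y hy)) (by simpa using hd))
      rw [map_zero] at this
      rw [AlgHom.comp_apply, map_zero, ← this, map_list_prod, List.map_map, List.map_map]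
      congr 3
      funext x
      exact actu_ι p g x⟩

theorem act_ι (g : GL (Fin n) F) (x : pn n F) : act p g (ι n F p x) = ι n F p (Ad g x) := by
  refine (RingQuot.liftAlgHom_mkAlgHom_apply F _ _ _).trans ?_
  rw [AlgHom.comp_apply, actu_ι]
  rfl

/-- The element `diag(t_1, …, t_n)` of the maximal torus `T` of `G`. -/
def torus (t : Fin n → Fˣ) : GL (Fin n) F where
  val := Matrix.diagonal fun i => (t i : F)
  inv := Matrix.diagonal fun i => ((t i)⁻¹ : Fˣ)
  val_inv := by simp [Matrix.diagonal_mul_diagonal]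
  inv_val := by simp [Matrix.diagonal_mul_diagonal]

end GroupAction

section HarishChandra

/-- Evaluation of a commutative polynomial at a commuting family in an algebra. -/
noncomputable def evalComm {n : ℕ} {F : Type*} [Field F] {A : Type*} [Ring A] [Algebra F A]
    (a : Fin n → A) (h : ∀ i j, a i * a j = a j * a i) : MvPolynomial (Fin n) F →ₐ[F] A :=
  letI : CommRing (Algebra.adjoin F (Set.range a)) :=
    { (inferInstance : Ring (Algebra.adjoin F (Set.range a))) with
      mul_comm := (Algebra.isMulCommutative_adjoin F (by
        rintro _ ⟨i, rfl⟩ _ ⟨j, rfl⟩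
        exact h i j)).is_comm.comm }
  (Algebra.adjoin F (Set.range a)).val.comp
    (MvPolynomial.aeval fun i => (⟨a i, Algebra.subset_adjoin ⟨i, rfl⟩⟩ :
      Algebra.adjoin F (Set.range a)))

theorem evalComm_X {n : ℕ} {F : Type*} [Field F] {A : Type*} [Ring A] [Algebra F A]
    (a : Fin n → A) (h : ∀ i j, a i * a j = a j * a i) (i : Fin n) :
    evalComm (F := F) a h (MvPolynomial.X i) = a i := by
  simp [evalComm]

variable (n : ℕ) (F : Type*) [Field F] (p : ℕ) [Fact p.Prime] [CharP F p]

/-- The central subalgebra `𝒵 = {z ∈ ū_0̄ : g z = z for all g ∈ G, [z, 𝔤_1̄] = 0}`. As `z` is even,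
its superbracket with any element is the commutator. -/
noncomputable def Z : Subalgebra F (ubar n F p) :=
  ubarEven n F p ⊓ (⨅ g : GL (Fin n) F, AlgHom.equalizer (act p g) (AlgHom.id F (ubar n F p))) ⊓
    Subalgebra.centralizer F (ι n F p '' (odd n F : Set (pn n F)))

/-- The algebra `ū^T` of invariants of the torus `T`. -/
noncomputable def ubarT : Subalgebra F (ubar n F p) :=
  ⨅ t : Fin n → Fˣ, AlgHom.equalizer (act p (torus t)) (AlgHom.id F (ubar n F p))

/-- `𝔩 = ū 𝔫⁺ ∩ ū^T`, where `ū 𝔫⁺` is the left ideal generated by `𝔫⁺`. -/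
noncomputable def lIdeal : Submodule F (ubar n F p) :=
  (Ideal.span (ι n F p '' (nPlus n F : Set (pn n F)))).restrictScalars F ⊓
    Subalgebra.toSubmodule (ubarT n F p)

/-- The ideal of `U(𝔥) = S(𝔥) = F[h_1, …, h_n]` generated by the `h_i ^ p - h_i`. -/
noncomputable def uhIdeal : Ideal (MvPolynomial (Fin n) F) :=
  Ideal.span (Set.range fun i => MvPolynomial.X i ^ p - MvPolynomial.X i)

/-- The restricted enveloping algebra `u(𝔥)` of the torus `𝔥` with basis `h_1, …, h_n`,
`h_i^{[p]} = h_i`. -/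
abbrev uh := MvPolynomial (Fin n) F ⧸ uhIdeal n F p

variable {n} in
/-- The element `h_i = e_{i,i} - e_{n+i,n+i}` of `𝔤`. -/
def hElt (i : Fin n) : pn n F :=
  ⟨Matrix.fromBlocks (Matrix.diagonal (Pi.single i 1)) 0 0
    (-Matrix.diagonal (Pi.single i 1)), mem_pn_fromBlocks.2 (by simp)⟩

variable {n} in
theorem hElt_even (i : Fin n) : hElt F i ∈ even n F := ⟨rfl, rfl⟩

theorem hElt_commute (i j : Fin n) :
    ι n F p (hElt F i) * ι n F p (hElt F j) = ι n F p (hElt F j) * ι n F p (hElt F i) := by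
  have h := mkU_rel (EnvRel.comm (hElt F i) (hElt F j) (hElt_even F i)
    (Or.inl (hElt_even F j)))
  have h0 : (⟨(hElt F i : Mat n F) * hElt F j - hElt F j * hElt F i,
      comm_mem _ _ (hElt_even F i) (Or.inl (hElt_even F j))⟩ : pn n F) = 0 := by
    ext1
    refine sub_eq_zero.2 ?_
    simp only [hElt, Matrix.fromBlocks_multiply]
    simp [Matrix.diagonal_mul_diagonal, mul_comm]
  rw [h0, map_zero, map_zero, map_sub, map_mul, map_mul, sub_eq_zero] at h
  have h2 := congrArg (fun a => mkubar n F p (mku n F p a)) h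
  simp only [map_mul] at h2
  exact h2

theorem hElt_pow (i : Fin n) : ι n F p (hElt F i) ^ p = ι n F p (hElt F i) := by
  have h := mku_rel p (ResRel.pow (p := p) (hElt F i) (hElt_even F i))
  have h0 : (⟨(hElt F i : Mat n F) ^ p, pow_mem p _ (hElt_even F i)⟩ : pn n F) = hElt F i := by
    ext1
    have hp : p ≠ 0 := (Fact.out : p.Prime).ne_zero
    have key : ∀ k : ℕ, (hElt F i : Mat n F) ^ (k + 1) =
        Matrix.fromBlocks (Matrix.diagonal (Pi.single i 1)) 0 0
          (Matrix.diagonal (Pi.single i ((-1 : F) ^ (k + 1)))) := by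
      intro k
      induction k with
      | zero => simp [hElt, Matrix.diagonal_neg, Pi.single_neg]
      | succ k ih =>
        rw [pow_succ, ih]
        simp only [hElt, Matrix.fromBlocks_multiply, Matrix.diagonal_neg]
        simp only [Matrix.diagonal_mul_diagonal, Matrix.mul_zero, Matrix.zero_mul, add_zero,
          zero_add, pow_succ]
        congr 2 <;> funext j <;> by_cases hj : j = i
        · subst hj; simp
        · simp [hj]
        · subst hj; simp
        · simp [hj]
    obtain ⟨k, hk⟩ := Nat.exists_eq_succ_of_ne_zero hp
    show (hElt F i : Mat n F) ^ p = hElt F i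
    rw [hk, key, ← Nat.succ_eq_add_one, ← hk, neg_one_pow_char F p]
    simp [hElt, Matrix.diagonal_neg, Pi.single_neg]
  rw [h0] at h
  rw [map_pow] at h
  have h2 := congrArg (mkubar n F p) h
  rw [map_pow] at h2
  exact h2

/-- The canonical algebra homomorphism `F[h_1, …, h_n] → ū`. -/
noncomputable def polyToUbar : MvPolynomial (Fin n) F →ₐ[F] ubar n F p :=
  evalComm (fun i => ι n F p (hElt F i)) (hElt_commute n F p)

theorem polyToUbar_X (i : Fin n) : polyToUbar n F p (MvPolynomial.X i) = ι n F p (hElt F i) := by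
  exact evalComm_X _ _ i

/-- The canonical algebra homomorphism `u(𝔥) → ū`, sending the generator `h_i` of `u(𝔥)` to the
class of `h_i ∈ 𝔤`. -/
noncomputable def uhToUbar : uh n F p →ₐ[F] ubar n F p :=
  Ideal.Quotient.liftₐ (uhIdeal n F p) (polyToUbar n F p) (by
    intro a ha
    have : uhIdeal n F p ≤ RingHom.ker (polyToUbar n F p) := by
      refine Ideal.span_le.2 ?_
      rintro _ ⟨i, rfl⟩
      show polyToUbar n F p _ = 0
      rw [map_sub, map_pow, polyToUbar_X, hElt_pow, sub_self]
    exact this ha)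

theorem uhToUbar_h (i : Fin n) :
    uhToUbar n F p (Ideal.Quotient.mk _ (MvPolynomial.X i)) = ι n F p (hElt F i) :=
  polyToUbar_X n F p i

variable {n F} in
/-- `f` is the image of `v ∈ ū^T` under the Harish-Chandra projection `ū^T = u(𝔥) ⊕ 𝔩 → u(𝔥)`
with kernel `𝔩`. -/
def IsHCImage (v : ubar n F p) (f : uh n F p) : Prop :=
  v ∈ ubarT n F p ∧ v - uhToUbar n F p f ∈ lIdeal n F p

/-- The image `h(𝒵)` of `𝒵` under the Harish-Chandra projection. -/
def hcZ : Set (uh n F p) := {f | ∃ z ∈ Z n F p, IsHCImage p z f}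

end HarishChandra

section DotAction

variable {n : ℕ} {F : Type*} [Field F]

/-- The coordinates `ρ(h_i)` of an element `ρ ∈ 𝔥*` with `ρ(h_i - h_{i+1}) = 1` for all `i`. -/
def rho (i : Fin n) : F := -(i.val : F)

/-- The dot action `w · λ = w (λ + ρ) - ρ` of `W = S_n` on `𝔥*`, in the coordinates
`λ_i = λ(h_i)`; here `w ε_k = ε_{w k}`. -/
def dotWeight (w : Equiv.Perm (Fin n)) (l : Fin n → F) (i : Fin n) : F :=
  l (w⁻¹ i) + rho (w⁻¹ i) - rho i

/-- The dot action of `W` on `U(𝔥) = F[h_1, …, h_n]`, as an algebra homomorphism; it is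
characterised by `(w · f)(λ) = f(w⁻¹ · λ)`. -/
noncomputable def dotPoly (w : Equiv.Perm (Fin n)) :
    MvPolynomial (Fin n) F →ₐ[F] MvPolynomial (Fin n) F :=
  MvPolynomial.aeval fun i => MvPolynomial.X (w i) + MvPolynomial.C (rho (w i) - rho i)

theorem eval_dotPoly (w : Equiv.Perm (Fin n)) (f : MvPolynomial (Fin n) F) (l : Fin n → F) :
    MvPolynomial.eval l (dotPoly w f) = MvPolynomial.eval (dotWeight w⁻¹ l) f := by
  induction f using MvPolynomial.induction_on with
  | C a => simp [dotPoly]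
  | add f g hf hg => simp [hf, hg]
  | mul_X f i hf =>
    rw [map_mul, map_mul, hf, map_mul]
    simp [dotPoly, dotWeight]
    ring_nf
    try simp

variable (p : ℕ) [Fact p.Prime] [CharP F p]

/-- The dot action of `W` on `u(𝔥)`. -/
noncomputable def dot (w : Equiv.Perm (Fin n)) : uh n F p →ₐ[F] uh n F p :=
  Ideal.quotientMapₐ (uhIdeal n F p) (dotPoly w) (by
    refine Ideal.span_le.2 ?_
    rintro _ ⟨i, rfl⟩
    show dotPoly w _ ∈ uhIdeal n F p
    have hc : ((rho (w i) - rho i : F)) ^ p = rho (w i) - rho i := by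
      have : (rho (w i) - rho i : F) = ((-(w i).val + i.val : ℤ) : F) := by
        simp [rho]
      rw [this]
      have h := congrArg (ZMod.castHom (dvd_refl p) F) (ZMod.pow_card ((-(w i).val + i.val : ℤ) : ZMod p))
      simpa only [map_pow, map_intCast] using h
    have h2 : dotPoly w (MvPolynomial.X i ^ p - MvPolynomial.X i : MvPolynomial (Fin n) F) =
        MvPolynomial.X (w i) ^ p - MvPolynomial.X (w i) := by
      simp only [dotPoly, map_sub, map_pow, MvPolynomial.aeval_X]
      rw [add_pow_char, ← map_sub, ← map_pow, hc]
      ring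
    rw [h2]
    exact Ideal.subset_span ⟨w i, rfl⟩)

variable (n F) in
/-- The invariants `u(𝔥)^{W·}` of the dot action. -/
noncomputable def uhInv : Subalgebra F (uh n F p) :=
  ⨅ w : Equiv.Perm (Fin n), AlgHom.equalizer (dot p w) (AlgHom.id F (uh n F p))

variable (n F) in
/-- `Θ = ∏_{i ≠ j} ((h_i - h_j)(μ + ρ) - 1) ∈ U(𝔥)`, as a polynomial function of `μ ∈ 𝔥*`. -/
noncomputable def thetaPoly : MvPolynomial (Fin n) F :=
  ∏ ij ∈ (Finset.univ : Finset (Fin n)).offDiag,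
    (MvPolynomial.X ij.1 - MvPolynomial.X ij.2 + MvPolynomial.C (rho ij.1 - rho ij.2) - 1)

theorem eval_thetaPoly (μ : Fin n → F) : MvPolynomial.eval μ (thetaPoly n F) =
    ∏ ij ∈ (Finset.univ : Finset (Fin n)).offDiag,
      ((μ ij.1 + rho ij.1) - (μ ij.2 + rho ij.2) - 1) := by
  rw [thetaPoly, map_prod]
  refine Finset.prod_congr rfl fun ij _ => ?_
  simp
  ring

variable (n F) in
/-- The image of `Θ` in `u(𝔥)`. -/
noncomputable def theta : uh n F p := Ideal.Quotient.mk _ (thetaPoly n F)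

end DotAction

end Periplectic

/-! The oscillator representation of `𝔤` on the Fock space `⋀(V₀ ⊗ F^S) ⊗ Sym(V₁ ⊗ F^S)` replaces
the Poincaré–Birkhoff–Witt theorem: Fock spaces contain highest weight vectors of every weight
`μ ∈ F_p^n`, and these generate modules over `ū`. An element `z` of `𝒵` acts on a highest weight
vector of weight `μ` by the scalar `h(z)(μ)`.

Powers of root vectors of `𝔤_0̄` take highest weight vectors to highest weight vectors of linked
weights, so `h(z)` is invariant under the dot action. An element of `𝔤_{-1}` links in the same way
two weights that differ by `1` in the coordinates `i` and `j` whenever `(μ + ρ)_i = (μ + ρ)_j + 1`.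
Together with the symmetry this makes `h(z)` equal to a constant `c` on the zeros of `Θ`, so that
`h(z) - c` is divisible by `Θ`.

The projection exists because `ū` is spanned by the subalgebra opposite to `𝔫⁺` and by `ū 𝔫⁺`, while
a one-parameter subgroup of `T` has positive weights on the opposite nilradical. It is unique
because an element of `𝔩` kills all highest weight vectors. -/

namespace Periplectic

/-! ### Fock space and second quantization -/

section FockSpace

open scoped TensorProduct

variable {ι κ S F : Type*} [Field F]

variable (ι κ S F) in
/-- The Fock space `⋀(V₀ ⊗ F^S) ⊗ Sym(V₁ ⊗ F^S)` of the superspace `V = V₀ ⊕ V₁` with bases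
indexed by `ι` and `κ`. It carries the oscillator representation of `𝔤𝔩(V)`, which stands in for
the PBW theorem as a source of highest weight modules. -/
def Fock := ExteriorAlgebra F (ι × S → F) ⊗[F] MvPolynomial (κ × S) F

namespace Fock

noncomputable instance : AddCommGroup (Fock ι κ S F) :=
  inferInstanceAs (AddCommGroup (_ ⊗[F] _))

noncomputable instance : Module F (Fock ι κ S F) := inferInstanceAs (Module F (_ ⊗[F] _))

variable (ι κ S F) in
/-- The vacuum vector `1 ⊗ 1`. -/
noncomputable def vacuum : Fock ι κ S F := (1 : ExteriorAlgebra F (ι × S → F)) ⊗ₜ 1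

theorem vacuum_ne_zero : vacuum ι κ S F ≠ 0 := fun h =>
  one_ne_zero ((Module.FaithfullyFlat.one_tmul_eq_zero_iff F (MvPolynomial (κ × S) F)
    (A := ExteriorAlgebra F (ι × S → F)) 1).1 h)

instance : Nontrivial (Fock ι κ S F) := ⟨_, _, vacuum_ne_zero⟩

/-- The action on the Fock space of the operators on its fermionic factor. -/
noncomputable def onFermions :
    Module.End F (ExteriorAlgebra F (ι × S → F)) →ₐ[F] Module.End F (Fock ι κ S F) :=
  Module.End.rTensorAlgHom F _ _

/-- The action on the Fock space of the operators on its bosonic factor. -/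
noncomputable def onBosons :
    Module.End F (MvPolynomial (κ × S) F) →ₐ[F] Module.End F (Fock ι κ S F) :=
  Module.End.lTensorAlgHom F _ _

theorem commute_onFermions_onBosons (f : Module.End F (ExteriorAlgebra F (ι × S → F)))
    (g : Module.End F (MvPolynomial (κ × S) F)) : Commute (onFermions f) (onBosons g) :=
  TensorProduct.ext' fun _ _ => rfl

theorem contractLeft_mul_mulLeft_ι {V : Type*} [AddCommGroup V] [Module F V]
    (d : Module.Dual F V) (v : V) :
    (CliffordAlgebra.contractLeft d * LinearMap.mulLeft F (ExteriorAlgebra.ι F v) :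
      Module.End F (ExteriorAlgebra F V)) =
      (-1 : F) • (LinearMap.mulLeft F (ExteriorAlgebra.ι F v) * CliffordAlgebra.contractLeft d) +
        d v • 1 := by
  refine LinearMap.ext fun x => (CliffordAlgebra.contractLeft_ι_mul (d := d) v x).trans ?_
  rw [LinearMap.add_apply, LinearMap.smul_apply, neg_one_smul, sub_eq_neg_add]
  rfl

theorem pderiv_mul_mulLeft_X {σ : Type*} [DecidableEq σ] (k l : σ) :
    (MvPolynomial.pderiv k).toLinearMap * LinearMap.mulLeft F (MvPolynomial.X l) =
      LinearMap.mulLeft F (MvPolynomial.X l) * (MvPolynomial.pderiv k).toLinearMap +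
        if k = l then 1 else 0 := by
  refine LinearMap.ext fun y => ?_
  simp only [Module.End.mul_apply, LinearMap.mulLeft_apply, LinearMap.add_apply,
    Derivation.coeFn_coe, Derivation.leibniz, MvPolynomial.pderiv_X, Pi.single_apply,
    smul_eq_mul, eq_comm (a := l)]
  split_ifs <;> simp

/-- The annihilation operators: contractions on the fermionic factor, partial derivatives on the
bosonic one. -/
noncomputable def annihilation : ι ⊕ κ → S → Module.End F (Fock ι κ S F)
  | .inl i, s => onFermions
      (CliffordAlgebra.contractLeft (Q := (0 : QuadraticForm F (ι × S → F)))
        (LinearMap.proj (i, s)))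
  | .inr k, s => onBosons (MvPolynomial.pderiv (k, s)).toLinearMap

theorem annihilation_vacuum (α : ι ⊕ κ) (s : S) : annihilation α s (vacuum ι κ S F) = 0 := by
  rcases α with i | k
  · exact (congrArg (· ⊗ₜ[F] 1) (CliffordAlgebra.contractLeft_one (Q := 0) _)).trans
      (TensorProduct.zero_tmul _ _)
  · exact (congrArg (1 ⊗ₜ[F] ·) (MvPolynomial.pderiv (k, s)).map_one_eq_zero).trans
      (TensorProduct.tmul_zero _ _)

variable (F) in
/-- The sign picked up when operators with these two indices are exchanged; indices in the left
summand are fermionic, those in the right summand bosonic. -/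
def exchangeSign : ι ⊕ κ → ι ⊕ κ → F
  | .inl _, .inl _ => -1
  | _, _ => 1

variable [DecidableEq ι] [DecidableEq S]

/-- The creation operators: multiplication by the generators of the two factors. -/
noncomputable def creation : ι ⊕ κ → S → Module.End F (Fock ι κ S F)
  | .inl i, s => onFermions (LinearMap.mulLeft F (ExteriorAlgebra.ι F (Pi.single (i, s) 1)))
  | .inr k, s => onBosons (LinearMap.mulLeft F (MvPolynomial.X (k, s)))

theorem creation_mul_creation (α β : ι ⊕ κ) (s t : S) :
    (creation α s * creation β t : Module.End F (Fock ι κ S F)) =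
      exchangeSign F α β • (creation β t * creation α s) := by
  rcases α with i | k <;> rcases β with j | l
  · simp only [creation, exchangeSign, ← map_mul, ← map_smul]
    congr 1
    refine LinearMap.ext fun x => ?_
    simp only [Module.End.mul_apply, LinearMap.mulLeft_apply, LinearMap.smul_apply, ← mul_assoc]
    rw [eq_neg_of_add_eq_zero_left (ExteriorAlgebra.ι_add_mul_swap _ _), neg_mul, neg_one_smul]
  · exact (commute_onFermions_onBosons _ _).trans (one_smul F _).symm
  · exact (commute_onFermions_onBosons _ _).symm.trans (one_smul F _).symm
  · simp only [creation, exchangeSign, ← map_mul, one_smul, Module.End.mul_eq_comp]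
    rw [← LinearMap.mulLeft_mul, ← LinearMap.mulLeft_mul, mul_comm]

theorem creation_inl_mul_self (i : ι) (s : S) :
    (creation (.inl i) s * creation (.inl i) s : Module.End F (Fock ι κ S F)) = 0 := by
  rw [creation, ← map_mul, Module.End.mul_eq_comp, ← LinearMap.mulLeft_mul,
    ExteriorAlgebra.ι_sq_zero, LinearMap.mulLeft_zero_eq_zero, map_zero]

theorem annihilation_mul_creation [DecidableEq κ] (α β : ι ⊕ κ) (s t : S) :
    (annihilation α s * creation β t : Module.End F (Fock ι κ S F)) =
      exchangeSign F α β • (creation β t * annihilation α s) +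
        if α = β ∧ s = t then 1 else 0 := by
  rcases α with i | k <;> rcases β with j | l
  · simp only [annihilation, creation, exchangeSign, ← map_mul, contractLeft_mul_mulLeft_ι,
      map_add, map_smul, LinearMap.proj_apply, Pi.single_apply, Prod.mk.injEq, Sum.inl.injEq,
      ite_smul, one_smul, zero_smul]
    split_ifs <;> simp
  · simpa [annihilation, creation, exchangeSign] using (commute_onFermions_onBosons _ _).eq
  · simpa [annihilation, creation, exchangeSign] using (commute_onFermions_onBosons _ _).eq.symm
  · simp only [annihilation, creation, exchangeSign, ← map_mul, pderiv_mul_mulLeft_X, map_add,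
      one_smul, Prod.mk.injEq, Sum.inr.injEq]
    split_ifs <;> simp

theorem eq_top_of_vacuum_mem [Finite ι] [Finite S] (K : Submodule F (Fock ι κ S F))
    (vacuum_mem : vacuum ι κ S F ∈ K)
    (creation_mem : ∀ α s, ∀ m ∈ K, creation α s m ∈ K) : K = ⊤ := by
  have : Fintype (ι × S) := Fintype.ofFinite _
  have one_tmul_mem (y : MvPolynomial (κ × S) F) :
      (1 : ExteriorAlgebra F (ι × S → F)) ⊗ₜ[F] y ∈ K := by
    induction y using MvPolynomial.induction_on with
    | C a =>
      rw [← mul_one (MvPolynomial.C a), ← MvPolynomial.smul_eq_C_mul, TensorProduct.tmul_smul]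
      exact K.smul_mem _ vacuum_mem
    | add p q hp hq => rw [TensorProduct.tmul_add]; exact K.add_mem hp hq
    | mul_X p k hp =>
      rw [mul_comm]
      exact creation_mem (.inr k.1) k.2 _ hp
  have tmul_mem (x : ExteriorAlgebra F (ι × S → F)) (y : MvPolynomial (κ × S) F) :
      x ⊗ₜ[F] y ∈ K := by
    induction x using CliffordAlgebra.left_induction with
    | algebraMap r =>
      rw [Algebra.algebraMap_eq_smul_one, ← TensorProduct.smul_tmul']
      exact K.smul_mem _ (one_tmul_mem y)
    | add a b ha hb => rw [TensorProduct.add_tmul]; exact K.add_mem ha hb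
    | ι_mul a v ha =>
      rw [← (Pi.basisFun F (ι × S)).sum_repr v, map_sum, Finset.sum_mul, TensorProduct.sum_tmul]
      refine K.sum_mem fun k _ => ?_
      rw [map_smul, smul_mul_assoc, ← TensorProduct.smul_tmul', Pi.basisFun_apply]
      exact K.smul_mem _ (creation_mem (.inl k.1) k.2 _ ha)
  refine Submodule.eq_top_iff'.2 fun m => ?_
  induction m using TensorProduct.induction_on with
  | zero => exact K.zero_mem
  | add x y hx hy => exact K.add_mem hx hy
  | tmul x y => exact tmul_mem x y

end Fock

end FockSpace

section BlockParity

variable {ι κ R : Type*}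

section

variable [Zero R]

/-- Block diagonal matrices, the even endomorphisms of a superspace. -/
def IsEven (X : Matrix (ι ⊕ κ) (ι ⊕ κ) R) : Prop := X.toBlocks₁₂ = 0 ∧ X.toBlocks₂₁ = 0

/-- Block off-diagonal matrices, the odd endomorphisms of a superspace. -/
def IsOdd (X : Matrix (ι ⊕ κ) (ι ⊕ κ) R) : Prop := X.toBlocks₁₁ = 0 ∧ X.toBlocks₂₂ = 0

theorem IsEven.eq_fromBlocks {X : Matrix (ι ⊕ κ) (ι ⊕ κ) R} (hX : IsEven X) :
    X = .fromBlocks X.toBlocks₁₁ 0 0 X.toBlocks₂₂ := by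
  rw [← hX.1, ← hX.2, Matrix.fromBlocks_toBlocks]

theorem IsOdd.eq_fromBlocks {X : Matrix (ι ⊕ κ) (ι ⊕ κ) R} (hX : IsOdd X) :
    X = .fromBlocks 0 X.toBlocks₁₂ X.toBlocks₂₁ 0 := by
  rw [← hX.1, ← hX.2, Matrix.fromBlocks_toBlocks]

end

section

variable [Ring R] {X Y : Matrix (ι ⊕ κ) (ι ⊕ κ) R}

theorem IsEven.add (hX : IsEven X) (hY : IsEven Y) : IsEven (X + Y) :=
  ⟨(congrArg₂ (· + ·) hX.1 hY.1).trans (add_zero 0),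
    (congrArg₂ (· + ·) hX.2 hY.2).trans (add_zero 0)⟩

theorem IsEven.sub (hX : IsEven X) (hY : IsEven Y) : IsEven (X - Y) :=
  ⟨(congrArg₂ (· - ·) hX.1 hY.1).trans (sub_zero 0),
    (congrArg₂ (· - ·) hX.2 hY.2).trans (sub_zero 0)⟩

theorem IsOdd.sub (hX : IsOdd X) (hY : IsOdd Y) : IsOdd (X - Y) :=
  ⟨(congrArg₂ (· - ·) hX.1 hY.1).trans (sub_zero 0),
    (congrArg₂ (· - ·) hX.2 hY.2).trans (sub_zero 0)⟩

variable [Fintype ι] [Fintype κ]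

theorem IsEven.mul (hX : IsEven X) (hY : IsEven Y) : IsEven (X * Y) := by
  rw [hX.eq_fromBlocks, hY.eq_fromBlocks, Matrix.fromBlocks_multiply]
  simp [IsEven]

theorem IsEven.mul_isOdd (hX : IsEven X) (hY : IsOdd Y) : IsOdd (X * Y) := by
  rw [hX.eq_fromBlocks, hY.eq_fromBlocks, Matrix.fromBlocks_multiply]
  simp [IsOdd]

theorem IsOdd.mul_isEven (hX : IsOdd X) (hY : IsEven Y) : IsOdd (X * Y) := by
  rw [hX.eq_fromBlocks, hY.eq_fromBlocks, Matrix.fromBlocks_multiply]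
  simp [IsOdd]

theorem IsOdd.mul (hX : IsOdd X) (hY : IsOdd Y) : IsEven (X * Y) := by
  rw [hX.eq_fromBlocks, hY.eq_fromBlocks, Matrix.fromBlocks_multiply]
  simp [IsEven]

variable [DecidableEq ι] [DecidableEq κ]

theorem IsEven.pow (hX : IsEven X) (k : ℕ) : IsEven (X ^ k) := by
  induction k with
  | zero => rw [pow_zero, ← Matrix.fromBlocks_one]; exact ⟨rfl, rfl⟩
  | succ k ih => rw [pow_succ]; exact ih.mul hX

variable (ι κ R) in
/-- The parity operator of a superspace, `-1` on the (fermionic) left summand and `1` on the right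
one. -/
def parity : Matrix (ι ⊕ κ) (ι ⊕ κ) R := .fromBlocks (-1) 0 0 1

theorem parity_mul_parity : parity ι κ R * parity ι κ R = 1 := by
  simp [parity, Matrix.fromBlocks_multiply]

theorem IsEven.mul_parity (hX : IsEven X) : X * parity ι κ R = parity ι κ R * X := by
  rw [hX.eq_fromBlocks]
  simp [parity, Matrix.fromBlocks_multiply]

theorem IsOdd.mul_parity (hX : IsOdd X) : X * parity ι κ R = -(parity ι κ R * X) := by
  rw [hX.eq_fromBlocks]
  simp [parity, Matrix.fromBlocks_multiply, Matrix.fromBlocks_neg]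

end

end BlockParity

namespace Fock

open scoped Matrix

variable {ι κ S F : Type*} [Field F] [Fintype ι] [Fintype κ] [DecidableEq ι] [DecidableEq S]

/-- The creation operators of copy `s` of `V`, extended linearly to `V`. -/
noncomputable def creationLin (s : S) : (ι ⊕ κ → F) →ₗ[F] Module.End F (Fock ι κ S F) :=
  Fintype.linearCombination F fun α => creation α s

theorem creationLin_single [DecidableEq κ] (s : S) (α : ι ⊕ κ) :
    creationLin s (Pi.single α (1 : F)) = creation α s := by
  simp [creationLin, Fintype.linearCombination_apply_single]

section TwistedDerivation

variable {P P' X X' : Matrix (ι ⊕ κ) (ι ⊕ κ) F} {Q Q' : Module.End F (Fock ι κ S F)}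

/-- `Q` is a derivation with symbol `X`, twisted by `P`: moving it past the creation operator of `v`
replaces `v` by `P v` and adds the creation operator of `X v`. -/
def IsTwistedDerivation (P X : Matrix (ι ⊕ κ) (ι ⊕ κ) F) (Q : Module.End F (Fock ι κ S F)) : Prop :=
  ∀ s v, Q * creationLin s v = creationLin s (P *ᵥ v) * Q + creationLin s (X *ᵥ v)

theorem isTwistedDerivation_iff : IsTwistedDerivation P X Q ↔
    ∀ s γ, Q * creation γ s = creationLin s (P.col γ) * Q + creationLin s (X.col γ) := by
  classical
  refine ⟨fun h s γ => ?_, fun h s v => ?_⟩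
  · rw [← creationLin_single, h, Matrix.mulVec_single_one, Matrix.mulVec_single_one]
  · suffices (LinearMap.mulLeft F Q).comp (creationLin s) =
        (LinearMap.mulRight F Q).comp ((creationLin s).comp P.mulVecLin) +
          (creationLin s).comp X.mulVecLin from LinearMap.congr_fun this v
    refine LinearMap.pi_ext' fun γ => LinearMap.ext_ring ?_
    simpa [creationLin_single] using h s γ

theorem IsTwistedDerivation.eq_of_vacuum [Finite S] (hQ : IsTwistedDerivation P X Q)
    (hQ' : IsTwistedDerivation P X Q') (vacuum_eq : Q (vacuum ι κ S F) = Q' (vacuum ι κ S F)) :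
    Q = Q' := by
  classical
  refine LinearMap.eqLocus_eq_top.1 (eq_top_of_vacuum_mem _ vacuum_eq fun α s m hm => ?_)
  rw [LinearMap.mem_eqLocus] at hm ⊢
  have h := LinearMap.congr_fun (hQ s (Pi.single α 1)) m
  have h' := LinearMap.congr_fun (hQ' s (Pi.single α 1)) m
  simp only [creationLin_single, Module.End.mul_apply, LinearMap.add_apply] at h h'
  rw [h, h', hm]

theorem IsTwistedDerivation.bracket (hQ : IsTwistedDerivation P X Q)
    (hQ' : IsTwistedDerivation P' X' Q') {ε : F} (hPP' : P * P' = P' * P)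
    (hXP' : X * P' = ε • (P' * X)) (hPX' : P * X' = ε • (X' * P)) :
    IsTwistedDerivation (P * P') (X * X' - ε • (X' * X)) (Q * Q' - ε • (Q' * Q)) := by
  intro s v
  have mul_mul : Q * Q' * creationLin s v = creationLin s ((P * P') *ᵥ v) * (Q * Q') +
      creationLin s ((X * P') *ᵥ v) * Q' + creationLin s ((P * X') *ᵥ v) * Q +
      creationLin s ((X * X') *ᵥ v) := by
    rw [mul_assoc, hQ', mul_add, ← mul_assoc, hQ, hQ]
    simp only [Matrix.mulVec_mulVec, add_mul, mul_assoc, add_assoc]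
  have mul_mul' : Q' * Q * creationLin s v = creationLin s ((P * P') *ᵥ v) * (Q' * Q) +
      creationLin s ((X' * P) *ᵥ v) * Q + creationLin s ((P' * X) *ᵥ v) * Q' +
      creationLin s ((X' * X) *ᵥ v) := by
    rw [mul_assoc, hQ, mul_add, ← mul_assoc, hQ', hQ', hPP']
    simp only [Matrix.mulVec_mulVec, add_mul, mul_assoc, add_assoc]
  rw [sub_mul, smul_mul_assoc, mul_mul, mul_mul', hXP', hPX']
  simp only [Matrix.sub_mulVec, Matrix.smul_mulVec, map_sub, map_smul, smul_add, mul_sub,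
    smul_mul_assoc, mul_smul_comm]
  abel

variable [DecidableEq κ]

/-- `ad(Q)^p = ad(Q^p)` in characteristic `p`. -/
theorem IsTwistedDerivation.pow_char {p : ℕ} [Fact p.Prime] [CharP F p]
    (hQ : IsTwistedDerivation 1 X Q) : IsTwistedDerivation 1 (X ^ p) (Q ^ p) := by
  have : CharP (Module.End F (Module.End F (Fock ι κ S F))) p :=
    charP_of_injective_algebraMap (algebraMap F _).injective p
  intro s v
  set ad := LinearMap.mulLeft F Q - LinearMap.mulRight F Q
  have ad_pow (k : ℕ) : (ad ^ k) (creationLin s v) = creationLin s ((X ^ k) *ᵥ v) := by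
    induction k with
    | zero => simp
    | succ k ih =>
      rw [pow_succ', Module.End.mul_apply, ih, LinearMap.sub_apply, LinearMap.mulLeft_apply,
        LinearMap.mulRight_apply, hQ, Matrix.one_mulVec, add_sub_cancel_left,
        Matrix.mulVec_mulVec, ← pow_succ']
  have := ad_pow p
  rw [sub_pow_char_of_commute p (LinearMap.commute_mulLeft_right _ _), LinearMap.pow_mulLeft,
    LinearMap.pow_mulRight, LinearMap.sub_apply, LinearMap.mulLeft_apply,
    LinearMap.mulRight_apply, sub_eq_iff_eq_add'] at this
  rw [this, Matrix.one_mulVec]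

end TwistedDerivation

section SecondQuantization

variable [Fintype S]

/-- The oscillator representation of `𝔤𝔩(V)` on the Fock space, sending `X` to
`∑ X_{βα} a_β† a_α`. -/
noncomputable def secondQuantization :
    Matrix (ι ⊕ κ) (ι ⊕ κ) F →ₗ[F] Module.End F (Fock ι κ S F) where
  toFun X := ∑ s, ∑ α, creationLin s (X.col α) * annihilation α s
  map_add' X Y := by
    simp only [← Finset.sum_add_distrib, ← add_mul, ← map_add]
    rfl
  map_smul' c X := by
    simp only [Finset.smul_sum, ← smul_mul_assoc, ← map_smul, RingHom.id_apply]
    rfl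

theorem secondQuantization_apply (X : Matrix (ι ⊕ κ) (ι ⊕ κ) F) :
    (secondQuantization X : Module.End F (Fock ι κ S F)) =
      ∑ s, ∑ α, creationLin s (X.col α) * annihilation α s := rfl

theorem secondQuantization_vacuum (X : Matrix (ι ⊕ κ) (ι ⊕ κ) F) :
    secondQuantization X (vacuum ι κ S F) = 0 := by
  simp [secondQuantization_apply, annihilation_vacuum]

/-- The hypothesis says that passing a homogeneous `a_β† a_α` through `a_γ†` costs the sign
`π γ`. -/
theorem isTwistedDerivation_secondQuantization [DecidableEq κ] {X : Matrix (ι ⊕ κ) (ι ⊕ κ) F}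
    {π : ι ⊕ κ → F}
    (hX : ∀ α β γ, exchangeSign F α γ * exchangeSign F β γ * X β α = π γ * X β α) :
    IsTwistedDerivation (Matrix.diagonal π) X
      (secondQuantization X : Module.End F (Fock ι κ S F)) := by
  rw [isTwistedDerivation_iff]
  intro t γ
  have exchange (s : S) (α : ι ⊕ κ) : exchangeSign F α γ • (creationLin s (X.col α) * creation γ t :
      Module.End F (Fock ι κ S F)) = π γ • (creation γ t * creationLin s (X.col α)) := by
    simp only [creationLin, Fintype.linearCombination_apply, Finset.sum_mul, Finset.mul_sum,
      Finset.smul_sum, smul_mul_assoc, mul_smul_comm, creation_mul_creation _ γ, smul_smul,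
      Matrix.col_apply]
    refine Finset.sum_congr rfl fun β _ => ?_
    rw [← hX, mul_right_comm, mul_assoc]
  have term (s : S) (α : ι ⊕ κ) :
      (creationLin s (X.col α) * annihilation α s * creation γ t : Module.End F (Fock ι κ S F)) =
        π γ • (creation γ t * (creationLin s (X.col α) * annihilation α s)) +
          if α = γ ∧ s = t then creationLin s (X.col α) else 0 := by
    rw [mul_assoc, annihilation_mul_creation, mul_add, mul_smul_comm, ← mul_assoc,
      ← smul_mul_assoc, exchange, smul_mul_assoc, mul_assoc, mul_ite, mul_one, mul_zero]
  have diagonal_col : (Matrix.diagonal π).col γ = π γ • Pi.single γ 1 := by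
    ext δ
    by_cases h : δ = γ <;> simp [h]
  simp only [secondQuantization_apply, Finset.sum_mul, term, Finset.sum_add_distrib,
    diagonal_col, map_smul, creationLin_single, smul_mul_assoc, Finset.mul_sum,
    ite_and, Finset.sum_ite_eq', Finset.mem_univ, if_true]

theorem isTwistedDerivation_of_isEven [DecidableEq κ] {X : Matrix (ι ⊕ κ) (ι ⊕ κ) F}
    (hX : IsEven X) :
    IsTwistedDerivation 1 X (secondQuantization X : Module.End F (Fock ι κ S F)) := by
  rw [← Matrix.diagonal_one]
  refine isTwistedDerivation_secondQuantization fun α β γ => ?_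
  rw [hX.eq_fromBlocks]
  rcases α with _ | _ <;> rcases β with _ | _ <;> rcases γ with _ | _ <;> simp [exchangeSign]

theorem isTwistedDerivation_of_isOdd [DecidableEq κ] {X : Matrix (ι ⊕ κ) (ι ⊕ κ) F}
    (hX : IsOdd X) :
    IsTwistedDerivation (parity ι κ F) X
      (secondQuantization X : Module.End F (Fock ι κ S F)) := by
  rw [parity, ← Matrix.diagonal_one, ← Matrix.diagonal_one, Matrix.diagonal_neg,
    Matrix.fromBlocks_diagonal]
  refine isTwistedDerivation_secondQuantization fun α β γ => ?_
  rw [hX.eq_fromBlocks]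
  rcases α with _ | _ <;> rcases β with _ | _ <;> rcases γ with _ | _ <;> simp [exchangeSign]

variable {X Y : Matrix (ι ⊕ κ) (ι ⊕ κ) F}

theorem secondQuantization_comm (hX : IsEven X) (hY : IsEven Y ∨ IsOdd Y) :
    (secondQuantization X * secondQuantization Y - secondQuantization Y * secondQuantization X :
      Module.End F (Fock ι κ S F)) = secondQuantization (X * Y - Y * X) := by
  classical
  have comm_of {P : Matrix (ι ⊕ κ) (ι ⊕ κ) F} (hP : X * P = P * X)
      (hY : IsTwistedDerivation P Y (secondQuantization Y : Module.End F (Fock ι κ S F)))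
      (hXY : IsTwistedDerivation P (X * Y - Y * X)
        (secondQuantization (X * Y - Y * X) : Module.End F (Fock ι κ S F))) :
      (secondQuantization X * secondQuantization Y - secondQuantization Y * secondQuantization X :
        Module.End F (Fock ι κ S F)) = secondQuantization (X * Y - Y * X) := by
    have := (isTwistedDerivation_of_isEven hX).bracket hY (ε := 1)
      (by rw [one_mul, mul_one]) (by rw [one_smul, hP]) (by rw [one_smul, one_mul, mul_one])
    simp only [one_smul, one_mul] at this
    exact this.eq_of_vacuum hXY (by simp [secondQuantization_vacuum])
  rcases hY with hY | hY
  · exact comm_of (by rw [one_mul, mul_one]) (isTwistedDerivation_of_isEven hY)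
      (isTwistedDerivation_of_isEven ((hX.mul hY).sub (hY.mul hX)))
  · exact comm_of hX.mul_parity (isTwistedDerivation_of_isOdd hY)
      (isTwistedDerivation_of_isOdd ((hX.mul_isOdd hY).sub (hY.mul_isEven hX)))

theorem secondQuantization_anticomm (hX : IsOdd X) (hY : IsOdd Y) :
    (secondQuantization X * secondQuantization Y + secondQuantization Y * secondQuantization X :
      Module.End F (Fock ι κ S F)) = secondQuantization (X * Y + Y * X) := by
  classical
  have := (isTwistedDerivation_of_isOdd hX).bracket (S := S) (isTwistedDerivation_of_isOdd hY)
    (ε := -1) rfl (by rw [neg_one_smul, hX.mul_parity])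
    (by rw [neg_one_smul, hY.mul_parity, neg_neg])
  simp only [neg_one_smul, sub_neg_eq_add, parity_mul_parity] at this
  exact this.eq_of_vacuum (isTwistedDerivation_of_isEven ((hX.mul hY).add (hY.mul hX)))
    (by simp [secondQuantization_vacuum])

theorem secondQuantization_pow_char [DecidableEq κ] {p : ℕ} [Fact p.Prime] [CharP F p]
    (hX : IsEven X) :
    (secondQuantization X ^ p : Module.End F (Fock ι κ S F)) = secondQuantization (X ^ p) := by
  refine (isTwistedDerivation_of_isEven hX).pow_char.eq_of_vacuum
    (isTwistedDerivation_of_isEven (hX.pow p)) ?_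
  obtain ⟨k, hk⟩ := Nat.exists_eq_succ_of_ne_zero (Fact.out : p.Prime).ne_zero
  rw [secondQuantization_vacuum, hk, pow_succ, Module.End.mul_apply, secondQuantization_vacuum,
    map_zero]

end SecondQuantization

end Fock

section Action

variable {n : ℕ} {S F : Type*} [Field F] [Fintype S] [DecidableEq S]

variable (n S F) in
/-- The action of `U(𝔤)` on the Fock space. -/
noncomputable def fockActionU : U n F →ₐ[F] Module.End F (Fock (Fin n) (Fin n) S F) :=
  RingQuot.liftAlgHom F ⟨TensorAlgebra.lift F (Fock.secondQuantization ∘ₗ (pn n F).subtype), by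
    rintro _ _ (⟨x, y, hx, hy⟩ | ⟨x, y, hx, hy⟩)
    · simp only [map_sub, map_mul, TensorAlgebra.lift_ι_apply]
      exact Fock.secondQuantization_comm hx hy
    · simp only [map_add, map_mul, TensorAlgebra.lift_ι_apply]
      exact Fock.secondQuantization_anticomm hx hy⟩

theorem fockActionU_ι (x : pn n F) :
    fockActionU n S F (ιU n F x) = Fock.secondQuantization (x : Mat n F) :=
  (RingQuot.liftAlgHom_mkAlgHom_apply F _ _ _).trans (TensorAlgebra.lift_ι_apply _ _)

variable (p : ℕ) [Fact p.Prime] [CharP F p]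

variable (n S F) in
/-- The action of `u(𝔤)` on the Fock space. -/
noncomputable def fockAction : u n F p →ₐ[F] Module.End F (Fock (Fin n) (Fin n) S F) :=
  RingQuot.liftAlgHom F ⟨fockActionU n S F, by
    rintro _ _ ⟨x, hx⟩
    rw [map_pow, fockActionU_ι, fockActionU_ι]
    exact Fock.secondQuantization_pow_char hx⟩

theorem fockAction_ι (x : pn n F) :
    fockAction n S F p (ιu n F p x) = Fock.secondQuantization (x : Mat n F) :=
  (RingQuot.liftAlgHom_mkAlgHom_apply F _ _ _).trans (fockActionU_ι x)

end Action

/-! ### Modules over `ū` -/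

section Relations

variable {n : ℕ} {F : Type*} [Field F] {p : ℕ} [Fact p.Prime] [CharP F p]

theorem two_ne_zero_of_char (hp : p ≠ 2) : (2 : F) ≠ 0 := by
  intro h
  have : p ∣ 2 := (CharP.cast_eq_zero_iff F p 2).1 (by exact_mod_cast h)
  exact hp ((Nat.prime_dvd_prime_iff_eq Fact.out Nat.prime_two).1 this)

@[elab_as_elim]
theorem u_induction {C : u n F p → Prop} (algebraMap : ∀ r, C (algebraMap F _ r))
    (ι : ∀ x, C (ιu n F p x)) (mul : ∀ a b, C a → C b → C (a * b))
    (add : ∀ a b, C a → C b → C (a + b)) (a : u n F p) : C a := by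
  let π : TensorAlgebra F (pn n F) →ₐ[F] u n F p := (mku n F p).comp (mkU n F)
  obtain ⟨a, rfl⟩ : ∃ t, π t = a := (RingQuot.mkAlgHom_surjective F (ResRel n F p)).comp
    (RingQuot.mkAlgHom_surjective F (EnvRel n F)) a
  induction a using TensorAlgebra.induction with
  | algebraMap r => rw [AlgHom.commutes]; exact algebraMap r
  | ι x => exact ι x
  | mul a b ha hb => rw [map_mul]; exact mul _ _ ha hb
  | add a b ha hb => rw [map_add]; exact add _ _ ha hb

theorem mkubar_surjective : Function.Surjective (mkubar n F p) :=
  RingQuot.mkAlgHom_surjective F (NilRel n F p)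

@[elab_as_elim]
theorem ubar_induction {C : ubar n F p → Prop} (algebraMap : ∀ r, C (algebraMap F _ r))
    (ι : ∀ x, C (ι n F p x)) (mul : ∀ a b, C a → C b → C (a * b))
    (add : ∀ a b, C a → C b → C (a + b)) (a : ubar n F p) : C a := by
  obtain ⟨a, rfl⟩ := mkubar_surjective a
  induction a using u_induction with
  | algebraMap r => rw [AlgHom.commutes]; exact algebraMap r
  | ι x => exact ι x
  | mul a b ha hb => rw [map_mul]; exact mul _ _ ha hb
  | add a b ha hb => rw [map_add]; exact add _ _ ha hb

/-- The element of `𝔤_0̄` with upper left block `A`. -/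
def aElt : Matrix (Fin n) (Fin n) F →ₗ[F] pn n F where
  toFun A := ⟨.fromBlocks A 0 0 (-A.transpose), mem_pn_fromBlocks.2 (by simp)⟩
  map_add' A B := Subtype.ext <| by simp [Matrix.fromBlocks_add, add_comm (-B.transpose)]
  map_smul' c A := by ext1; simp [Matrix.fromBlocks_smul]

/-- The element of `𝔤_1` with upper right block `X + Xᵀ`. Every symmetric matrix has this form,
since `2` is invertible. -/
def bElt : Matrix (Fin n) (Fin n) F →ₗ[F] pn n F where
  toFun X := ⟨.fromBlocks 0 (X + X.transpose) 0 0, mem_pn_fromBlocks.2 (by simp [add_comm])⟩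
  map_add' X Y := by ext1; simp [Matrix.fromBlocks_add, add_add_add_comm]
  map_smul' c X := by ext1; simp [Matrix.fromBlocks_smul]

/-- The element of `𝔤_{-1}` with lower left block `X - Xᵀ`. Every skew-symmetric matrix has this
form, since `2` is invertible. -/
def cElt : Matrix (Fin n) (Fin n) F →ₗ[F] pn n F where
  toFun X := ⟨.fromBlocks 0 0 (X - X.transpose) 0, mem_pn_fromBlocks.2 (by simp)⟩
  map_add' X Y := by ext1; simp [Matrix.fromBlocks_add, add_sub_add_comm]
  map_smul' c X := by ext1; simp [Matrix.fromBlocks_smul, smul_sub]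

theorem coe_aElt (A : Matrix (Fin n) (Fin n) F) :
    (aElt A : Mat n F) = .fromBlocks A 0 0 (-A.transpose) := rfl

theorem coe_bElt (X : Matrix (Fin n) (Fin n) F) :
    (bElt X : Mat n F) = .fromBlocks 0 (X + X.transpose) 0 0 := rfl

theorem coe_cElt (X : Matrix (Fin n) (Fin n) F) :
    (cElt X : Mat n F) = .fromBlocks 0 0 (X - X.transpose) 0 := rfl

theorem aElt_mem_even (A : Matrix (Fin n) (Fin n) F) : aElt A ∈ even n F := ⟨rfl, rfl⟩

theorem bElt_mem_degOne (X : Matrix (Fin n) (Fin n) F) : bElt X ∈ degOne n F := ⟨⟨rfl, rfl⟩, rfl⟩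

theorem cElt_mem_odd (X : Matrix (Fin n) (Fin n) F) : cElt X ∈ odd n F := ⟨rfl, rfl⟩

theorem exists_eq_aElt_add_bElt_add_cElt (hp : p ≠ 2) (x : pn n F) :
    ∃ A X Y, x = aElt A + bElt X + cElt Y := by
  obtain ⟨x, hx⟩ := x
  obtain ⟨A, B, C, D, rfl⟩ : ∃ A B C D, x = .fromBlocks A B C D :=
    ⟨_, _, _, _, (Matrix.fromBlocks_toBlocks x).symm⟩
  obtain ⟨hD, hB, hC⟩ := mem_pn_fromBlocks.1 hx
  have half_add_half (M : Matrix (Fin n) (Fin n) F) : (2⁻¹ : F) • M + (2⁻¹ : F) • M = M := by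
    rw [← add_smul, ← two_mul, mul_inv_cancel₀ (two_ne_zero_of_char hp), one_smul]
  refine ⟨A, (2⁻¹ : F) • B, (2⁻¹ : F) • C, Subtype.ext ?_⟩
  simp [coe_aElt, coe_bElt, coe_cElt, hB, hC, hD, Matrix.fromBlocks_smul, Matrix.fromBlocks_add,
    half_add_half]

theorem exists_eq_bElt (hp : p ≠ 2) {x : pn n F} (hx : x ∈ degOne n F) : ∃ X, x = bElt X := by
  obtain ⟨A, X, Y, rfl⟩ := exists_eq_aElt_add_bElt_add_cElt hp x
  obtain ⟨⟨hA, -⟩, hY⟩ := hx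
  obtain rfl : A = 0 := by
    simpa [coe_aElt, coe_bElt, coe_cElt, Matrix.fromBlocks_add] using hA
  refine ⟨X, ?_⟩
  have : cElt Y = 0 := Subtype.ext (by
    rw [coe_cElt, show Y - Y.transpose = 0 by
      simpa [coe_aElt, coe_bElt, coe_cElt, Matrix.fromBlocks_add] using hY]
    simp)
  rw [this, map_zero, zero_add, add_zero]

section Brackets

variable {R : Type*} [Ring R] [Algebra F R] (g : u n F p →ₐ[F] R)

theorem map_ιu_comm {x y z : pn n F} (hx : x ∈ even n F) (hy : y ∈ even n F ∨ y ∈ odd n F)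
    (hz : (x : Mat n F) * y - y * x = z) :
    g (ιu n F p x) * g (ιu n F p y) = g (ιu n F p y) * g (ιu n F p x) + g (ιu n F p z) := by
  obtain rfl : ⟨_, comm_mem x y hx hy⟩ = z := Subtype.ext hz
  have := congrArg (g.comp (mku n F p)) (mkU_rel (.comm x y hx hy))
  simp only [map_sub, map_mul] at this
  exact sub_eq_iff_eq_add'.1 this

theorem map_ιu_anticomm {x y z : pn n F} (hx : x ∈ odd n F) (hy : y ∈ odd n F)
    (hz : (x : Mat n F) * y + y * x = z) :
    g (ιu n F p x) * g (ιu n F p y) = -(g (ιu n F p y) * g (ιu n F p x)) + g (ιu n F p z) := by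
  obtain rfl : ⟨_, anticomm_mem x y hx hy⟩ = z := Subtype.ext hz
  have := congrArg (g.comp (mku n F p)) (mkU_rel (.anticomm x y hx hy))
  simp only [map_add, map_mul] at this
  exact (eq_sub_of_add_eq this).trans (neg_add_eq_sub _ _).symm

variable (A A' X Y : Matrix (Fin n) (Fin n) F)

theorem map_aElt_mul_aElt :
    g (ιu n F p (aElt A)) * g (ιu n F p (aElt A')) =
      g (ιu n F p (aElt A')) * g (ιu n F p (aElt A)) +
        g (ιu n F p (aElt (A * A' - A' * A))) := by
  refine map_ιu_comm g (aElt_mem_even A) (.inl (aElt_mem_even A')) ?_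
  simp [coe_aElt, Matrix.fromBlocks_multiply, sub_eq_add_neg, Matrix.fromBlocks_neg,
    Matrix.fromBlocks_add, add_comm]

theorem map_aElt_mul_bElt :
    g (ιu n F p (aElt A)) * g (ιu n F p (bElt X)) =
      g (ιu n F p (bElt X)) * g (ιu n F p (aElt A)) +
        g (ιu n F p (bElt (A * X + X * A.transpose))) := by
  refine map_ιu_comm g (aElt_mem_even A) (.inr (bElt_mem_degOne X).1) ?_
  have : A * (X + X.transpose) + (X + X.transpose) * A.transpose =
      A * X + X * A.transpose + (A * X + X * A.transpose).transpose := by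
    simp only [Matrix.transpose_add, Matrix.transpose_mul, Matrix.transpose_transpose]
    noncomm_ring
  rw [coe_bElt (_ + _), ← this]
  simp [coe_aElt, coe_bElt, Matrix.fromBlocks_multiply, sub_eq_add_neg, Matrix.fromBlocks_neg,
    Matrix.fromBlocks_add]

theorem map_aElt_mul_cElt :
    g (ιu n F p (aElt A)) * g (ιu n F p (cElt X)) =
      g (ιu n F p (cElt X)) * g (ιu n F p (aElt A)) +
        g (ιu n F p (cElt (-(A.transpose * X + X * A)))) := by
  refine map_ιu_comm g (aElt_mem_even A) (.inr (cElt_mem_odd X)) ?_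
  have : -(A.transpose * (X - X.transpose)) - (X - X.transpose) * A =
      -(A.transpose * X + X * A) - (-(A.transpose * X + X * A)).transpose := by
    simp only [Matrix.transpose_add, Matrix.transpose_mul, Matrix.transpose_transpose,
      Matrix.transpose_neg]
    noncomm_ring
  rw [coe_cElt (-_), ← this]
  simp [coe_aElt, coe_cElt, Matrix.fromBlocks_multiply, sub_eq_add_neg, Matrix.fromBlocks_neg,
    Matrix.fromBlocks_add]

theorem map_bElt_mul_cElt :
    g (ιu n F p (bElt X)) * g (ιu n F p (cElt Y)) =
      -(g (ιu n F p (cElt Y)) * g (ιu n F p (bElt X))) +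
        g (ιu n F p (aElt ((X + X.transpose) * (Y - Y.transpose)))) := by
  refine map_ιu_anticomm g (bElt_mem_degOne X).1 (cElt_mem_odd Y) ?_
  have : -((X + X.transpose) * (Y - Y.transpose)).transpose =
      (Y - Y.transpose) * (X + X.transpose) := by
    rw [Matrix.transpose_mul, ← neg_mul]
    simp [add_comm]
  simp only [coe_aElt, this]
  simp [coe_bElt, coe_cElt, Matrix.fromBlocks_multiply, Matrix.fromBlocks_add]

theorem map_cElt_mul_cElt :
    g (ιu n F p (cElt X)) * g (ιu n F p (cElt Y)) =
      -(g (ιu n F p (cElt Y)) * g (ιu n F p (cElt X))) := by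
  rw [map_ιu_anticomm g (z := 0) (cElt_mem_odd X) (cElt_mem_odd Y)
    (by simp [coe_cElt, Matrix.fromBlocks_multiply]), map_zero, map_zero, add_zero]

theorem map_cElt_mul_self (hp : p ≠ 2) :
    g (ιu n F p (cElt X)) * g (ιu n F p (cElt X)) = 0 := by
  have := map_cElt_mul_cElt g X X
  rw [eq_neg_iff_add_eq_zero, ← two_smul F] at this
  exact (smul_eq_zero.1 this).resolve_left (two_ne_zero_of_char hp)

end Brackets

theorem finrank_range_cElt_le :
    Module.finrank F (LinearMap.range (cElt : Matrix (Fin n) (Fin n) F →ₗ[F] pn n F)) ≤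
      n * (n - 1) / 2 := by
  let upper : LinearMap.range (cElt : Matrix (Fin n) (Fin n) F →ₗ[F] pn n F) →ₗ[F]
      ((Σ j : Fin n, Fin j) → F) :=
    { toFun x k := (x : Mat n F) (.inr ⟨k.2, k.2.2.trans k.1.2⟩) (.inl k.1)
      map_add' _ _ := rfl
      map_smul' _ _ := rfl }
  have upper_injective : Function.Injective upper := by
    rw [injective_iff_map_eq_zero]
    rintro ⟨_, X, rfl⟩ hX
    have upper_eq {i j : Fin n} (hij : i < j) : X i j = X j i :=
      sub_eq_zero.1 (congrFun hX ⟨j, i, hij⟩)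
    suffices X - X.transpose = 0 from Subtype.ext (Subtype.ext (by simp [coe_cElt, this]))
    ext i j
    rw [Matrix.sub_apply, Matrix.transpose_apply, Matrix.zero_apply, sub_eq_zero]
    rcases lt_trichotomy i j with hij | rfl | hij
    exacts [upper_eq hij, rfl, (upper_eq hij).symm]
  refine (LinearMap.finrank_le_finrank_of_injective upper_injective).trans_eq ?_
  rw [Module.finrank_pi, Fintype.card_sigma]
  simp only [Fintype.card_fin]
  rw [Fin.sum_univ_eq_sum_range (fun i => i), Finset.sum_range_id]

end Relations

/-- The product is the image of an exterior product of linearly dependent vectors. -/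
theorem prod_ofFn_eq_zero {F V A : Type*} [Field F] [AddCommGroup V] [Module F V] [Ring A]
    [Algebra F A] (f : V →ₗ[F] A) [Module.Finite F (LinearMap.range f)] (hf : ∀ c, f c * f c = 0)
    {k : ℕ} (hk : Module.finrank F (LinearMap.range f) < k) (v : Fin k → V) :
    (List.ofFn fun i => f (v i)).prod = 0 := by
  let incl := (LinearMap.range f).subtype
  have incl_sq (c : LinearMap.range f) : incl c * incl c = 0 := by
    obtain ⟨_, c, rfl⟩ := c
    exact hf c
  have : ExteriorAlgebra.ιMulti F k (f.rangeRestrict ∘ v) = 0 := by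
    refine AlternatingMap.map_linearDependent _ _ fun hv => hk.not_ge ?_
    simpa using hv.fintype_card_le_finrank
  rw [← map_zero (ExteriorAlgebra.lift F ⟨incl, incl_sq⟩), ← this, ExteriorAlgebra.ιMulti_apply,
    map_list_prod, List.map_ofFn]
  congr 2
  funext i
  exact (ExteriorAlgebra.lift_ι_apply F incl incl_sq (f.rangeRestrict (v i))).symm

section Restriction

variable {n : ℕ} {F : Type*} [Field F] {p : ℕ} [Fact p.Prime] [CharP F p]
  {M : Type*} [AddCommGroup M] [Module F M] (Φ : u n F p →ₐ[F] Module.End F M)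

/-- The subspaces `⋀^k 𝔤_{-1} M^{𝔤_1}` of a `u(𝔤)`-module `M`. -/
noncomputable def layer : ℕ → Submodule F M
  | 0 => ⨅ X, LinearMap.ker (Φ (ιu n F p (bElt X)))
  | k + 1 => ⨆ X, (layer k).map (Φ (ιu n F p (cElt X)))

variable {Φ} {m : M}

theorem mem_layer_zero : m ∈ layer Φ 0 ↔ ∀ X, Φ (ιu n F p (bElt X)) m = 0 := by
  simp [layer]

theorem cElt_mem_layer_succ (X : Matrix (Fin n) (Fin n) F) {k : ℕ} (hm : m ∈ layer Φ k) :
    Φ (ιu n F p (cElt X)) m ∈ layer Φ (k + 1) :=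
  Submodule.mem_iSup_of_mem X (Submodule.mem_map_of_mem hm)

theorem apply_mem_of_mem_layer_succ {k : ℕ} {N : Submodule F M} {f : Module.End F M}
    (h : ∀ X, ∀ w ∈ layer Φ k, f (Φ (ιu n F p (cElt X)) w) ∈ N) (hm : m ∈ layer Φ (k + 1)) :
    f m ∈ N :=
  (iSup_le fun X => Submodule.map_le_iff_le_comap.2 (h X) : layer Φ (k + 1) ≤ N.comap f) hm

theorem aElt_mem_layer (A : Matrix (Fin n) (Fin n) F) {k : ℕ} (hm : m ∈ layer Φ k) :
    Φ (ιu n F p (aElt A)) m ∈ layer Φ k := by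
  induction k generalizing m with
  | zero =>
    rw [mem_layer_zero] at hm ⊢
    intro X
    have := LinearMap.congr_fun (map_aElt_mul_bElt Φ A X) m
    simp only [LinearMap.add_apply, Module.End.mul_apply, hm, map_zero, add_zero] at this
    exact this.symm
  | succ k ih =>
    refine apply_mem_of_mem_layer_succ (fun X w hw => ?_) hm
    rw [← Module.End.mul_apply, map_aElt_mul_cElt]
    exact add_mem (cElt_mem_layer_succ X (ih hw)) (cElt_mem_layer_succ _ hw)

theorem bElt_mem_layer (X : Matrix (Fin n) (Fin n) F) {k : ℕ} (hm : m ∈ layer Φ (k + 1)) :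
    Φ (ιu n F p (bElt X)) m ∈ layer Φ k := by
  have bElt_cElt (Y : Matrix (Fin n) (Fin n) F) (w : M) :
      Φ (ιu n F p (bElt X)) (Φ (ιu n F p (cElt Y)) w) =
        -Φ (ιu n F p (cElt Y)) (Φ (ιu n F p (bElt X)) w) +
          Φ (ιu n F p (aElt ((X + X.transpose) * (Y - Y.transpose)))) w :=
    LinearMap.congr_fun (map_bElt_mul_cElt Φ X Y) w
  induction k generalizing m with
  | zero =>
    refine apply_mem_of_mem_layer_succ (fun Y w hw => ?_) hm
    rw [bElt_cElt, mem_layer_zero.1 hw, map_zero, neg_zero, zero_add]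
    exact aElt_mem_layer _ hw
  | succ k ih =>
    refine apply_mem_of_mem_layer_succ (fun Y w hw => ?_) hm
    rw [bElt_cElt]
    exact add_mem (neg_mem (cElt_mem_layer_succ Y (ih hw))) (aElt_mem_layer _ hw)

theorem map_iSup_layer_le (hp : p ≠ 2) (x : u n F p) :
    (⨆ k, layer Φ k).map (Φ x) ≤ ⨆ k, layer Φ k := by
  induction x using u_induction with
  | algebraMap r =>
    rintro _ ⟨w, hw, rfl⟩
    rw [AlgHom.commutes]
    exact Submodule.smul_mem _ r hw
  | mul a b ha hb =>
    rw [map_mul, Module.End.mul_eq_comp, Submodule.map_comp]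
    exact (Submodule.map_mono hb).trans ha
  | add a b ha hb =>
    rw [map_add]
    exact (Submodule.map_add_le _ _ _).trans (sup_le ha hb)
  | ι x =>
    obtain ⟨A, X, Y, rfl⟩ := exists_eq_aElt_add_bElt_add_cElt hp x
    rw [Submodule.map_iSup]
    refine iSup_le fun k => ?_
    rintro _ ⟨w, hw, rfl⟩
    simp only [map_add, LinearMap.add_apply]
    refine add_mem (add_mem ?_ ?_) ?_
    · exact Submodule.mem_iSup_of_mem k (aElt_mem_layer A hw)
    · cases k with
      | zero => rw [mem_layer_zero.1 hw]; exact zero_mem _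
      | succ k => exact Submodule.mem_iSup_of_mem k (bElt_mem_layer X hw)
    · exact Submodule.mem_iSup_of_mem (k + 1) (cElt_mem_layer_succ Y hw)

variable (Φ) in
theorem layer_le_iSup_range_prod (k : ℕ) : layer Φ k ≤ ⨆ v : Fin k → Matrix (Fin n) (Fin n) F,
    LinearMap.range (List.ofFn fun i => Φ (ιu n F p (cElt (v i)))).prod := by
  induction k with
  | zero => exact fun m _ => Submodule.mem_iSup_of_mem Fin.elim0 ⟨m, by simp⟩
  | succ k ih =>
    refine iSup_le fun X => (Submodule.map_mono ih).trans ?_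
    rw [Submodule.map_iSup]
    refine iSup_le fun v => le_iSup_of_le (Fin.cons X v) ?_
    rw [← LinearMap.range_comp, List.ofFn_succ, List.prod_cons]
    rfl

theorem layer_eq_bot (hp : p ≠ 2) {k : ℕ} (hk : n * (n - 1) / 2 < k) : layer Φ k = ⊥ := by
  let f : Matrix (Fin n) (Fin n) F →ₗ[F] Module.End F M := (Φ.toLinearMap ∘ₗ ιu n F p) ∘ₗ cElt
  have rank_lt : Module.finrank F (LinearMap.range f) < k := by
    rw [LinearMap.range_comp]
    exact ((Submodule.finrank_map_le _ _).trans finrank_range_cElt_le).trans_lt hk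
  refine eq_bot_iff.2 ((layer_le_iSup_range_prod Φ k).trans (iSup_le fun v => ?_))
  rw [show (List.ofFn fun i => Φ (ιu n F p (cElt (v i)))).prod = 0 from
    prod_ofFn_eq_zero f (fun c => map_cElt_mul_self Φ c hp) rank_lt v, LinearMap.range_zero]

theorem prod_degOne_eq_zero_of_mem_layer (hp : p ≠ 2) {l : List (pn n F)}
    (hl : ∀ x ∈ l, x ∈ degOne n F) {k : ℕ} (hk : k < l.length) (hm : m ∈ layer Φ k) :
    Φ (l.map (ιu n F p)).prod m = 0 := by
  induction l using List.reverseRecOn generalizing k m with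
  | nil => simp at hk
  | append_singleton l b ih =>
    obtain ⟨X, rfl⟩ := exists_eq_bElt hp (hl b (by simp))
    rw [List.map_append, List.prod_append, map_mul, Module.End.mul_apply, List.map_singleton,
      List.prod_singleton]
    cases k with
    | zero => rw [mem_layer_zero.1 hm, map_zero]
    | succ k =>
      exact ih (fun x hx => hl x (List.mem_append_left _ hx)) (by simpa using hk)
        (bElt_mem_layer X hm)

variable (Φ)

/-- The largest `u(𝔤)`-submodule of `M` killed by the ideal `I`. -/
noncomputable def nilPart : Submodule F M :=
  ⨅ (x : u n F p) (y : u n F p) (_ : NilRel n F p y 0), LinearMap.ker (Φ (y * x))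

theorem mem_nilPart : m ∈ nilPart Φ ↔ ∀ x y, NilRel n F p y 0 → Φ (y * x) m = 0 := by
  simp only [nilPart, Submodule.mem_iInf, LinearMap.mem_ker]

theorem apply_mem_nilPart (x : u n F p) : ∀ m ∈ nilPart Φ, Φ x m ∈ nilPart Φ := by
  intro m hm
  rw [mem_nilPart] at hm ⊢
  intro x' y hy
  rw [← Module.End.mul_apply, ← map_mul, mul_assoc]
  exact hm (x' * x) y hy

/-- The action of `ū` on `nilPart`. -/
noncomputable def nilAction : ubar n F p →ₐ[F] Module.End F (nilPart Φ) :=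
  RingQuot.liftAlgHom F ⟨AlgHom.ofLinearMap
    { toFun x := (Φ x).restrict (apply_mem_nilPart Φ x)
      map_add' _ _ := by ext; simp
      map_smul' _ _ := by ext; simp }
    (by ext; simp) (fun _ _ => by ext; simp), by
    rintro _ _ ⟨l, hl, hd⟩
    ext m
    have := (mem_nilPart Φ).1 m.2 1 _ (NilRel.prod l hl hd)
    rw [mul_one] at this
    rw [map_zero]
    exact this⟩

theorem nilAction_ι (x : pn n F) (m : nilPart Φ) :
    (nilAction Φ (ι n F p x) m : M) = Φ (ιu n F p x) m :=
  congrArg (fun f : Module.End F (nilPart Φ) => (f m : M))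
    (RingQuot.liftAlgHom_mkAlgHom_apply F _ _ (ιu n F p x))

/-- Vectors killed by `𝔤_1` generate modules over `ū` because `⋀^k 𝔤_{-1}` vanishes for `k > d`. -/
theorem layer_zero_le_nilPart (hp : p ≠ 2) : layer Φ 0 ≤ nilPart Φ := by
  intro m hm
  rw [mem_nilPart]
  rintro x _ ⟨l, hl, hd⟩
  rw [map_mul, Module.End.mul_apply, ← LinearMap.mem_ker]
  suffices ⨆ k, layer Φ k ≤ LinearMap.ker (Φ (l.map (ιu n F p)).prod) from
    this (map_iSup_layer_le hp x (Submodule.mem_map_of_mem (Submodule.mem_iSup_of_mem 0 hm)))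
  refine iSup_le fun k w hw => ?_
  by_cases hk : k < l.length
  · exact prod_degOne_eq_zero_of_mem_layer hp hl hk hw
  · rw [layer_eq_bot hp (hd.trans_le (not_lt.1 hk)), Submodule.mem_bot] at hw
    rw [hw]
    exact zero_mem _

end Restriction

/-! ### Linkage of weights -/

section Linkage

variable {ι β : Type*} [DecidableEq ι] {p : ℕ} [Fact p.Prime]

theorem periodic_of_forall_single [Finite ι] {L : (ι → ZMod p) → β} {a : ZMod p} (ha : a ≠ 0)
    (h : ∀ k, Function.Periodic L (Pi.single k a)) (v : ι → ZMod p) : Function.Periodic L v := by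
  have := Fintype.ofFinite ι
  rw [← Finset.univ_sum_single v]
  refine Finset.sum_induction _ _ (fun _ _ => .add_period) (fun μ => by rw [add_zero]) fun k _ => ?_
  rw [← div_mul_cancel₀ (v k) ha, ← ZMod.natCast_zmod_val (v k / a), ← nsmul_eq_mul, Pi.single_smul]
  exact (h k).nsmul _

omit [DecidableEq ι] in
theorem exists_perm_map_pair {i₀ j₀ i j : ι} (h₀ : i₀ ≠ j₀) (h : i ≠ j) :
    ∃ w : Equiv.Perm ι, w i₀ = i ∧ w j₀ = j :=
  MulAction.is_two_pretransitive_iff.1 (Equiv.Perm.isMultiplyPretransitive ι 2) h₀ h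

/-- The point `l` with the coordinates `i` and `j` shifted by `t`. -/
def pairShift (i j : ι) (t : ZMod p) (l : ι → ZMod p) : ι → ZMod p :=
  l + (Pi.single i t + Pi.single j t)

theorem pairShift_comp (i j : ι) (t : ZMod p) (l : ι → ZMod p) (w : Equiv.Perm ι) :
    pairShift (w i) (w j) t l ∘ w = pairShift i j t (l ∘ w) := by
  funext k
  simp [pairShift, Pi.single_apply]

variable {G : (ι → ZMod p) → β}

theorem forall_pairShift_of_symmetric (hG : ∀ (w : Equiv.Perm ι) l, G (l ∘ w) = G l)
    {i₀ j₀ : ι} (h₀ : i₀ ≠ j₀) (hs : ∀ l, l i₀ = l j₀ + 1 → G (pairShift i₀ j₀ 1 l) = G l)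
    {i j : ι} (hij : i ≠ j) {l : ι → ZMod p} (hl : l i = l j + 1) :
    G (pairShift i j 1 l) = G l := by
  obtain ⟨w, rfl, rfl⟩ := exists_perm_map_pair h₀ hij
  rw [← hG w, pairShift_comp, hs (l ∘ w) hl, hG]

variable (hs : ∀ i j, i ≠ j → ∀ l : ι → ZMod p, l i = l j + 1 → G (pairShift i j 1 l) = G l)
include hs

theorem apply_pairShift {i j : ι} (hij : i ≠ j) {l : ι → ZMod p} (hl : l i = l j + 1)
    (t : ZMod p) : G (pairShift i j t l) = G l := by
  rw [← ZMod.natCast_zmod_val t]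
  induction t.val with
  | zero => simp [pairShift]
  | succ m ih =>
    rw [← ih, ← hs i j hij (pairShift i j m l) (by simp [pairShift, hij, hij.symm, hl]; ring)]
    simp only [pairShift, Nat.cast_succ, Pi.single_add, add_assoc, add_left_comm]

theorem apply_add_single_two_of_eq {i j k : ι} (hij : i ≠ j) (hki : k ≠ i) (hkj : k ≠ j)
    {l : ι → ZMod p} (hi : l i = l k + 2) (hj : l j = l k + 1) : G (l + Pi.single k 2) = G l :=
  calc G (l + Pi.single k 2)
    _ = G (pairShift i j (-1) (pairShift i k 1 (pairShift j k 1 l))) := by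
      congr 1
      simp only [pairShift, Pi.single_neg, ← one_add_one_eq_two (R := ZMod p), Pi.single_add]
      abel
    _ = G (pairShift i k 1 (pairShift j k 1 l)) :=
      apply_pairShift hs hij (by
        simp [pairShift, hij, hij.symm, hki.symm, hkj.symm, hi, hj]; ring) _
    _ = G (pairShift j k 1 l) :=
      hs i k hki.symm _ (by simp [pairShift, hij, hki.symm, hkj, hi]; ring)
    _ = G l := hs j k hkj.symm l hj

theorem apply_add_single_two {i j k : ι} (hij : i ≠ j) (hki : k ≠ i) (hkj : k ≠ j)
    {l : ι → ZMod p} (hl : l i = l j + 1) : G (l + Pi.single k 2) = G l := by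
  let t := l k + 1 - l j
  calc G (l + Pi.single k 2)
    _ = G (pairShift i j t (l + Pi.single k 2)) :=
      (apply_pairShift hs hij (by simp [hki.symm, hkj.symm, hl]) t).symm
    _ = G (pairShift i j t l + Pi.single k 2) := by rw [pairShift, pairShift, add_right_comm]
    _ = G (pairShift i j t l) := by
      apply apply_add_single_two_of_eq hs hij hki hkj
      · simp [pairShift, hij, hki, hkj, hl, t]
        ring
      · simp [pairShift, hij.symm, hki, hkj, t]
    _ = G l := apply_pairShift hs hij hl t

theorem eq_of_pair [Finite ι] (hp : p ≠ 2) {i j : ι} (hij : i ≠ j) {l l' : ι → ZMod p}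
    (hl : l i = l j + 1) (hl' : l' i = l' j + 1) : G l = G l' := by
  have := Fintype.ofFinite ι
  let K (μ : ι → ZMod p) : β := G (Function.update μ i (μ j + 1))
  have K_periodic (k : ι) : Function.Periodic K (Pi.single k 2) := by
    intro μ
    have hμ : Function.update μ i (μ j + 1) i = Function.update μ i (μ j + 1) j + 1 := by
      simp [hij.symm]
    obtain rfl | hki := eq_or_ne k i
    · refine congrArg G (funext fun m => ?_)
      simp only [Pi.add_apply, Pi.single_apply, Function.update_apply]
      grind
    obtain rfl | hkj := eq_or_ne k j
    · refine .trans (congrArg G (funext fun m => ?_)) (apply_pairShift hs hij hμ 2)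
      simp only [pairShift, Pi.add_apply, Pi.single_apply, Function.update_apply]
      grind
    · refine .trans (congrArg G (funext fun m => ?_)) (apply_add_single_two hs hij hki hkj hμ)
      simp only [Pi.add_apply, Pi.single_apply, Function.update_apply]
      grind
  have apply_eq {l : ι → ZMod p} (hl : l i = l j + 1) : G l = K l := by
    simp only [K, ← hl, Function.update_eq_self]
  rw [apply_eq hl, apply_eq hl', ← periodic_of_forall_single (two_ne_zero_of_char hp) K_periodic
    (l - l') l', add_sub_cancel]

omit hs

theorem eq_of_symmetric_of_pairShift [Finite ι] (hp : p ≠ 2)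
    (hG : ∀ (w : Equiv.Perm ι) l, G (l ∘ w) = G l)
    {i₀ j₀ : ι} (h₀ : i₀ ≠ j₀) (hs : ∀ l, l i₀ = l j₀ + 1 → G (pairShift i₀ j₀ 1 l) = G l)
    {l l' : ι → ZMod p} {i j i' j' : ι} (hij : i ≠ j) (hl : l i = l j + 1)
    (hij' : i' ≠ j') (hl' : l' i' = l' j' + 1) : G l = G l' := by
  obtain ⟨w, rfl, rfl⟩ := exists_perm_map_pair hij hij'
  rw [← hG w l']
  exact eq_of_pair (fun _ _ h _ => forall_pairShift_of_symmetric hG h₀ hs h) hp hij hl hl'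

end Linkage

section Functions

variable {n : ℕ} {F : Type*} [Field F] {p : ℕ} [Fact p.Prime] [CharP F p]

variable (F) in
/-- A point of `F_p^n` as a point of `F^n`. -/
noncomputable def castPoint (a : Fin n → ZMod p) (i : Fin n) : F :=
  ZMod.castHom (dvd_refl p) F (a i)

variable (F) in
/-- Evaluation of the elements of `u(𝔥)`, viewed as functions on `F_p^n`. -/
noncomputable def evalUh (a : Fin n → ZMod p) : uh n F p →ₐ[F] F :=
  Ideal.Quotient.liftₐ (uhIdeal n F p) (MvPolynomial.aeval (castPoint F a)) <| by
    suffices uhIdeal n F p ≤ RingHom.ker (MvPolynomial.aeval (R := F) (castPoint F a)) from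
      fun f hf => this hf
    refine Ideal.span_le.2 ?_
    rintro _ ⟨i, rfl⟩
    rw [SetLike.mem_coe, RingHom.mem_ker, map_sub, map_pow, MvPolynomial.aeval_X, castPoint,
      ← map_pow, ZMod.pow_card, sub_self]

theorem evalUh_mk (a : Fin n → ZMod p) (f : MvPolynomial (Fin n) F) :
    evalUh F a (Ideal.Quotient.mk _ f) = MvPolynomial.eval (castPoint F a) f :=
  congrFun (MvPolynomial.aeval_eq_eval (castPoint F a)) f

theorem prod_sub_castHom {R : Type*} [CommRing R] [Algebra F R] (x : R) :
    ∏ r : ZMod p, (x - algebraMap F R (ZMod.castHom (dvd_refl p) F r)) = x ^ p - x := by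
  let e : ZMod p →+* R := (algebraMap F R).comp (ZMod.castHom (dvd_refl p) F)
  have monic : (Polynomial.X ^ p - Polynomial.X : Polynomial (ZMod p)).Monic :=
    Polynomial.monic_X_pow_sub (by
      rw [Polynomial.degree_X]; exact_mod_cast (Fact.out : p.Prime).one_lt)
  have splits : (Polynomial.X ^ p - Polynomial.X : Polynomial (ZMod p)).Splits := by
    simpa using FiniteField.splits_X_pow_card_sub_X (K := ZMod p) p
  have roots : (Polynomial.X ^ p - Polynomial.X : Polynomial (ZMod p)).roots =
      Finset.univ.val := by
    simpa using FiniteField.roots_X_pow_card_sub_X (ZMod p)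
  have := congrArg (Polynomial.eval₂ e x) (splits.eq_prod_roots_of_monic monic)
  rw [roots] at this
  simpa [Polynomial.eval₂_finsetProd, e] using this.symm

/-- This is the combinatorial Nullstellensatz for `F_p^n ⊆ F^n`. -/
theorem uh_ext {f g : uh n F p} (h : ∀ a, evalUh F a f = evalUh F a g) : f = g := by
  obtain ⟨f, rfl⟩ := Ideal.Quotient.mk_surjective f
  obtain ⟨g, rfl⟩ := Ideal.Quotient.mk_surjective g
  simp only [evalUh_mk] at h
  let e : ZMod p ↪ F := ⟨_, (ZMod.castHom (dvd_refl p) F).injective⟩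
  obtain ⟨q, -, hq⟩ := MvPolynomial.combinatorial_nullstellensatz_exists_linearCombination
    (fun _ : Fin n => Finset.univ.map e) (fun _ => Finset.univ_nonempty.map) (f - g) (by
      intro x hx
      obtain ⟨a, rfl⟩ : ∃ a, castPoint F a = x := by
        choose a ha using fun i => Finset.mem_map.1 (hx i)
        exact ⟨a, funext fun i => (ha i).2⟩
      rw [map_sub, h, sub_self])
  rw [Ideal.Quotient.eq, hq, Finsupp.linearCombination_apply]
  refine Ideal.sum_mem _ fun i _ => Ideal.mul_mem_left _ _ (Ideal.subset_span ⟨i, ?_⟩)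
  rw [Finset.prod_map]
  exact (prod_sub_castHom (MvPolynomial.X i)).symm

theorem exists_evalUh_eq (g : (Fin n → ZMod p) → F) : ∃ q : uh n F p, ∀ a, evalUh F a q = g a := by
  refine ⟨Ideal.Quotient.mk _ (∑ b, MvPolynomial.C (g b) *
    ∏ i, (1 - (MvPolynomial.X i - MvPolynomial.C (castPoint F b i)) ^ (p - 1))), fun a => ?_⟩
  rw [evalUh_mk, map_sum, Finset.sum_eq_single a]
  · simp [map_prod, Nat.sub_ne_zero_of_lt (Fact.out : p.Prime).one_lt]
  · intro b _ hb
    obtain ⟨i, hi⟩ := Function.ne_iff.1 hb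
    rw [map_mul, map_prod, Finset.prod_eq_zero (Finset.mem_univ i), mul_zero]
    simp only [map_sub, map_one, map_pow, MvPolynomial.eval_X, MvPolynomial.eval_C]
    rw [castPoint, castPoint, ← map_sub, ← map_pow,
      ZMod.pow_card_sub_one_eq_one (sub_ne_zero.2 hi.symm), map_one, sub_self]
  · simp

theorem castPoint_dotWeight (w : Equiv.Perm (Fin n)) (a : Fin n → ZMod p) :
    castPoint F (dotWeight w a) = dotWeight w (castPoint F a) := by
  funext i
  simp [castPoint, dotWeight, rho]

theorem evalUh_dot (w : Equiv.Perm (Fin n)) (a : Fin n → ZMod p) (f : uh n F p) :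
    evalUh F a (dot p w f) = evalUh F (dotWeight w⁻¹ a) f := by
  obtain ⟨f, rfl⟩ := Ideal.Quotient.mk_surjective f
  change evalUh F a (Ideal.Quotient.mk _ (dotPoly w f)) = _
  rw [evalUh_mk, evalUh_mk, eval_dotPoly, castPoint_dotWeight]

theorem mem_uhInv {q : uh n F p} (h : ∀ w a, evalUh F (dotWeight w a) q = evalUh F a q) :
    q ∈ uhInv n F p := by
  rw [uhInv, Algebra.mem_iInf]
  exact fun w => uh_ext fun a => (evalUh_dot w a q).trans (h _ a)

theorem evalUh_theta (a : Fin n → ZMod p) :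
    evalUh F a (theta n F p) = ∏ ij ∈ (Finset.univ : Finset (Fin n)).offDiag,
      ((castPoint F a ij.1 + rho ij.1) - (castPoint F a ij.2 + rho ij.2) - 1) := by
  rw [theta, evalUh_mk, eval_thetaPoly]

theorem dotWeight_add_rho {K : Type*} [Field K] (w : Equiv.Perm (Fin n)) (a : Fin n → K)
    (i : Fin n) : dotWeight w a i + rho i = a (w⁻¹ i) + rho (w⁻¹ i) :=
  sub_add_cancel _ _

theorem evalUh_theta_dotWeight (w : Equiv.Perm (Fin n)) (a : Fin n → ZMod p) :
    evalUh F (dotWeight w a) (theta n F p) = evalUh F a (theta n F p) := by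
  simp only [evalUh_theta, castPoint_dotWeight, dotWeight_add_rho]
  exact Finset.prod_equiv (Equiv.prodCongr w⁻¹ w⁻¹) (by simp) fun _ _ => rfl

theorem exists_of_evalUh_theta_eq_zero {a : Fin n → ZMod p} (h : evalUh F a (theta n F p) = 0) :
    ∃ i j, i ≠ j ∧ a i + rho i = a j + rho j + 1 := by
  rw [evalUh_theta, Finset.prod_eq_zero_iff] at h
  obtain ⟨⟨i, j⟩, hij, h⟩ := h
  refine ⟨i, j, by simpa using hij, (ZMod.castHom (dvd_refl p) F).injective ?_⟩
  rw [sub_sub, sub_eq_zero] at h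
  simpa [castPoint, rho] using h

theorem exists_eq_theta_mul_add {f : uh n F p}
    (hW : ∀ w a, evalUh F (dotWeight w a) f = evalUh F a f)
    (hΘ : ∀ a b, evalUh F a (theta n F p) = 0 → evalUh F b (theta n F p) = 0 →
      evalUh F a f = evalUh F b f) :
    ∃ q ∈ uhInv n F p, ∃ c : F, f = theta n F p * q + algebraMap F (uh n F p) c := by
  obtain ⟨c, hc⟩ : ∃ c, ∀ a, evalUh F a (theta n F p) = 0 → evalUh F a f = c := by
    by_cases! h : ∃ a, evalUh F a (theta n F p) = 0
    · obtain ⟨a, ha⟩ := h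
      exact ⟨evalUh F a f, fun b hb => hΘ b a hb ha⟩
    · exact ⟨0, fun a ha => absurd ha (h a)⟩
  obtain ⟨q, hq⟩ := exists_evalUh_eq (F := F)
    (fun a : Fin n → ZMod p => (evalUh F a f - c) / evalUh F a (theta n F p))
  refine ⟨q, mem_uhInv fun w a => ?_, c, uh_ext fun a => ?_⟩
  · rw [hq, hq, hW, evalUh_theta_dotWeight]
  · rw [map_add, map_mul, hq, AlgHom.commutes, Algebra.algebraMap_self_apply]
    obtain h | h := eq_or_ne (evalUh F a (theta n F p)) 0
    · rw [h, hc a h, zero_mul, zero_add]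
    · rw [mul_div_cancel₀ _ h, sub_add_cancel]

end Functions

/-! ### Highest weight vectors -/

section Singular

variable {n : ℕ} {F : Type*} [Field F] {p : ℕ} [Fact p.Prime] [CharP F p]
  {M : Type*} [AddCommGroup M] [Module F M]

/-- `v` is a highest weight vector of weight `a ∈ F_p^n` in a `u(𝔤)`-module. -/
structure IsSingular (Φ : u n F p →ₐ[F] Module.End F M) (a : Fin n → ZMod p) (v : M) : Prop where
  ne_zero : v ≠ 0
  upper : ∀ A : Matrix (Fin n) (Fin n) F, (∀ i j, j ≤ i → A i j = 0) →
    Φ (ιu n F p (aElt A)) v = 0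
  degOne : ∀ X, Φ (ιu n F p (bElt X)) v = 0
  diag : ∀ d : Fin n → F,
    Φ (ιu n F p (aElt (Matrix.diagonal d))) v = (∑ i, d i * castPoint F a i) • v

theorem hElt_eq_aElt (i : Fin n) : hElt F i = aElt (Matrix.diagonal (Pi.single i 1)) := by
  ext1
  simp [hElt, coe_aElt]

theorem exists_eq_of_mem_nPlus (hp : p ≠ 2) {x : pn n F} (hx : x ∈ nPlus n F) :
    ∃ A X, (∀ i j, j ≤ i → A i j = 0) ∧ x = aElt A + bElt X := by
  obtain ⟨A, X, Y, rfl⟩ := exists_eq_aElt_add_bElt_add_cElt hp x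
  have hY : Y - Y.transpose = 0 := by
    simpa [coe_aElt, coe_bElt, coe_cElt, Matrix.fromBlocks_add] using hx.1
  refine ⟨A, X, fun i j hij => by simpa [coe_aElt, coe_bElt, coe_cElt] using hx.2 i j hij, ?_⟩
  rw [add_eq_left]
  exact Subtype.ext (by simp [coe_cElt, hY])

namespace IsSingular

variable {Φ : u n F p →ₐ[F] Module.End F M} {a : Fin n → ZMod p} {v : M} (h : IsSingular Φ a v)
include h

theorem apply_hElt (i : Fin n) : Φ (ιu n F p (hElt F i)) v = castPoint F a i • v := by
  simp [hElt_eq_aElt, h.diag, Pi.single_apply]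

theorem mem_nilPart (hp : p ≠ 2) : v ∈ nilPart Φ :=
  layer_zero_le_nilPart Φ hp (mem_layer_zero.2 h.degOne)

theorem apply_nPlus (hp : p ≠ 2) {x : pn n F} (hx : x ∈ nPlus n F) : Φ (ιu n F p x) v = 0 := by
  obtain ⟨A, X, hA, rfl⟩ := exists_eq_of_mem_nPlus hp hx
  rw [map_add, map_add, LinearMap.add_apply, h.upper A hA, h.degOne X, add_zero]

theorem nilAction_uhToUbar (hv : v ∈ nilPart Φ) (f : uh n F p) :
    nilAction Φ (uhToUbar n F p f) ⟨v, hv⟩ = evalUh F a f • ⟨v, hv⟩ := by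
  obtain ⟨f, rfl⟩ := Ideal.Quotient.mk_surjective f
  rw [evalUh_mk]
  change nilAction Φ (polyToUbar n F p f) ⟨v, hv⟩ = _
  induction f using MvPolynomial.induction_on with
  | C c =>
    rw [← MvPolynomial.algebraMap_eq, AlgHom.commutes, AlgHom.commutes,
      Module.algebraMap_end_apply, MvPolynomial.algebraMap_eq, MvPolynomial.eval_C]
  | add f g hf hg => rw [map_add, map_add, map_add, LinearMap.add_apply, hf, hg, add_smul]
  | mul_X f i hf =>
    have : nilAction Φ (ι n F p (hElt F i)) ⟨v, hv⟩ = castPoint F a i • ⟨v, hv⟩ :=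
      Subtype.ext ((nilAction_ι Φ _ _).trans (h.apply_hElt i))
    rw [map_mul, map_mul, map_mul, Module.End.mul_apply, polyToUbar_X, this, map_smul, hf,
      MvPolynomial.eval_X, smul_smul, mul_comm]

theorem nilAction_lIdeal (hp : p ≠ 2) (hv : v ∈ nilPart Φ) {y : ubar n F p}
    (hy : y ∈ lIdeal n F p) : nilAction Φ y ⟨v, hv⟩ = 0 := by
  refine Submodule.span_induction (p := fun y _ => nilAction Φ y ⟨v, hv⟩ = 0) ?_ (by simp)
    (fun x y _ _ hx hy => by rw [map_add, LinearMap.add_apply, hx, hy, add_zero])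
    (fun r x _ hx => by rw [smul_eq_mul, map_mul, Module.End.mul_apply, hx, map_zero]) hy.1
  rintro _ ⟨x, hx, rfl⟩
  exact Subtype.ext ((nilAction_ι Φ _ _).trans (h.apply_nPlus hp hx))

/-- A representative of `z` modulo `ū 𝔫⁺` acts on highest weight vectors as `z`. -/
theorem nilAction_of_sub_mem (hp : p ≠ 2) (hv : v ∈ nilPart Φ) {z : ubar n F p}
    {f : uh n F p} (hz : z - uhToUbar n F p f ∈ lIdeal n F p) :
    nilAction Φ z ⟨v, hv⟩ = evalUh F a f • ⟨v, hv⟩ := by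
  rw [← h.nilAction_uhToUbar, ← sub_eq_zero, ← LinearMap.sub_apply, ← map_sub,
    h.nilAction_lIdeal hp hv hz]

end IsSingular

end Singular

namespace Fock

open scoped Finset

variable {ι κ S F : Type*} [Field F] [DecidableEq ι] [DecidableEq S]

/-- `v` is a Fock state in which exactly the fermionic modes in `D` are occupied and no bosonic
mode is. -/
structure IsOccupied (D : Finset (ι × S)) (v : Fock ι κ S F) : Prop where
  ne_zero : v ≠ 0
  creation : ∀ i s, (i, s) ∈ D → creation (.inl i) s v = 0
  annihilation : ∀ i s, (i, s) ∉ D → annihilation (.inl i) s v = 0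
  annihilation_inr : ∀ k s, Fock.annihilation (.inr k) s v = 0

theorem annihilation_creation [DecidableEq κ] (α β : ι ⊕ κ) (s t : S) (m : Fock ι κ S F) :
    annihilation α s (creation β t m) = exchangeSign F α β • creation β t (annihilation α s m) +
      if α = β ∧ s = t then m else 0 := by
  refine (LinearMap.congr_fun (annihilation_mul_creation α β s t) m).trans ?_
  split_ifs <;> rfl

theorem IsOccupied.insert {D : Finset (ι × S)} {v : Fock ι κ S F} (hv : IsOccupied D v) {i : ι}
    {s : S} (his : (i, s) ∉ D) : IsOccupied (insert (i, s) D) (Fock.creation (.inl i) s v) := by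
  classical
  refine ⟨fun h => ?_, fun j t hjt => ?_, fun j t hjt => ?_, fun k t => ?_⟩
  · have := annihilation_creation (.inl i) (.inl i) s s v
    simp only [h, hv.annihilation i s his, map_zero, smul_zero, zero_add, and_self, if_true] at this
    exact hv.ne_zero this.symm
  · rcases Finset.mem_insert.1 hjt with h | h
    · obtain ⟨rfl, rfl⟩ := Prod.mk.inj h
      exact LinearMap.congr_fun (creation_inl_mul_self _ _) v
    · refine (LinearMap.congr_fun (creation_mul_creation (.inl j) (.inl i) t s) v).trans ?_
      rw [LinearMap.smul_apply, Module.End.mul_apply, hv.creation j t h, map_zero, smul_zero]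
  · rw [Finset.mem_insert, not_or] at hjt
    rw [annihilation_creation, hv.annihilation j t hjt.2, map_zero, smul_zero, zero_add, if_neg]
    rintro ⟨h, rfl⟩
    exact hjt.1 (Prod.ext (Sum.inl_injective h) rfl)
  · rw [annihilation_creation, hv.annihilation_inr, map_zero, smul_zero, zero_add, if_neg]
    simp

variable (κ F) in
theorem exists_isOccupied (D : Finset (ι × S)) : ∃ v : Fock ι κ S F, IsOccupied D v := by
  induction D using Finset.induction_on with
  | empty =>
    exact ⟨_, vacuum_ne_zero, by simp, fun _ _ _ => annihilation_vacuum _ _,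
      fun _ _ => annihilation_vacuum _ _⟩
  | insert d D hd ih =>
    obtain ⟨v, hv⟩ := ih
    exact ⟨_, hv.insert hd⟩

theorem IsOccupied.creation_annihilation {D : Finset (ι × S)} {v : Fock ι κ S F}
    (hv : IsOccupied D v) {i j : ι} {s : S} (hjs : (j, s) ∈ D) :
    Fock.creation (.inl j) s (Fock.annihilation (.inl i) s v) = if i = j then v else 0 := by
  classical
  have := annihilation_creation (.inl i) (.inl j) s s v
  simp only [hv.creation j s hjs, map_zero, exchangeSign, neg_smul, one_smul, Sum.inl.injEq,
    and_true] at this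
  exact neg_add_eq_zero.1 this.symm

variable [Fintype ι] [Fintype κ]

theorem creationLin_apply (s : S) (v : ι ⊕ κ → F) (m : Fock ι κ S F) :
    creationLin s v m = ∑ α, v α • creation α s m := by
  simp [creationLin, Fintype.linearCombination_apply, LinearMap.sum_apply]

section IsTwistedDerivation

variable {P X : Matrix (ι ⊕ κ) (ι ⊕ κ) F} {Q : Module.End F (Fock ι κ S F)}

theorem IsTwistedDerivation.apply_creation (hQ : IsTwistedDerivation P X Q) (γ : ι ⊕ κ) (s : S)
    (m : Fock ι κ S F) :
    Q (creation γ s m) = creationLin s (P.col γ) (Q m) + creationLin s (X.col γ) m :=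
  LinearMap.congr_fun (isTwistedDerivation_iff.1 hQ s γ) m

end IsTwistedDerivation

variable [Fintype S] {D : Finset (ι × S)} {v : Fock ι κ S F}

/-- The weight of `i` is the number of occupied modes over `i`; a block that only moves particles
into occupied modes acts through its diagonal. -/
theorem IsOccupied.secondQuantization_fromBlocks (hv : IsOccupied D v) {A : Matrix ι ι F}
    (hA : ∀ i j s, A j i ≠ 0 → (i, s) ∈ D → (j, s) ∈ D) (B : Matrix ι κ F) (B' : Matrix κ κ F) :
    secondQuantization (.fromBlocks A B 0 B') v =
      (∑ i, A i i * (#{s | (i, s) ∈ D} : F)) • v := by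
  have term (s : S) (i j : ι) :
      A j i • Fock.creation (.inl j) s (Fock.annihilation (.inl i) s v) =
        if i = j then if (i, s) ∈ D then A i i • v else 0 else 0 := by
    by_cases his : (i, s) ∈ D
    · by_cases hji : A j i = 0
      · rw [hji, zero_smul]
        split_ifs with hij
        · rw [← hij] at hji
          rw [hji, zero_smul]
        · rfl
      · rw [hv.creation_annihilation (hA i j s hji his)]
        aesop
    · simp [hv.annihilation i s his, his]
  simp only [secondQuantization_apply, LinearMap.sum_apply, LinearMap.add_apply,
    Module.End.mul_apply, creationLin_apply, Fintype.sum_sum_type, hv.annihilation_inr, map_zero,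
    Finset.sum_const_zero, add_zero, Matrix.col_apply, Matrix.fromBlocks_apply₁₁,
    Matrix.fromBlocks_apply₂₁, Matrix.zero_apply, zero_smul, term, Finset.sum_ite_eq,
    Finset.mem_univ, if_true]
  rw [Finset.sum_comm, Finset.sum_smul]
  refine Finset.sum_congr rfl fun i _ => ?_
  rw [← Finset.sum_filter, Finset.sum_const, mul_comm, mul_smul, Nat.cast_smul_eq_nsmul]

theorem IsOccupied.secondQuantization_lower_ne_zero (hv : IsOccupied D v) {C : Matrix κ ι F} {k : κ}
    {j : ι} {s : S} (hjs : (j, s) ∈ D) (hkj : C k j ≠ 0) :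
    secondQuantization (.fromBlocks 0 0 C 0) v ≠ 0 := by
  classical
  intro h
  have isOdd : IsOdd (Matrix.fromBlocks 0 0 C 0) := ⟨rfl, rfl⟩
  have hC := (isTwistedDerivation_of_isOdd (S := S) isOdd).apply_creation (.inl j) s v
  rw [hv.creation j s hjs, h, map_zero, map_zero, zero_add, creationLin_apply] at hC
  have := congrArg (Fock.annihilation (.inr k) s) hC
  simp only [Fintype.sum_sum_type, Matrix.col_apply, Matrix.fromBlocks_apply₁₁,
    Matrix.fromBlocks_apply₂₁, Matrix.zero_apply, zero_smul, Finset.sum_const_zero, zero_add,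
    map_zero, map_sum, map_smul, annihilation_creation, hv.annihilation_inr, smul_zero,
    Sum.inr.injEq, and_true, smul_ite, Finset.sum_ite_eq, Finset.mem_univ, if_true] at this
  exact hv.ne_zero ((smul_eq_zero.1 this.symm).resolve_left hkj)

section Lowering

variable {i j : ι} (B : Matrix κ κ F)

theorem commute_secondQuantization_single_creation (hij : i ≠ j) (s : S) :
    Commute (secondQuantization (.fromBlocks (.single j i 1) 0 0 B))
      (creation (.inl j) s : Module.End F (Fock ι κ S F)) := by
  classical
  have isEven : IsEven (Matrix.fromBlocks (.single j i (1 : F)) 0 0 B) := ⟨rfl, rfl⟩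
  refine LinearMap.ext fun m => ?_
  rw [Module.End.mul_apply, Module.End.mul_apply,
    (isTwistedDerivation_of_isEven isEven).apply_creation]
  simp [creationLin_apply, Fintype.sum_sum_type, Matrix.one_apply, hij]

theorem secondQuantization_single_creation (s : S) (m : Fock ι κ S F) :
    secondQuantization (.fromBlocks (.single j i 1) 0 0 B) (creation (.inl i) s m) =
      creation (.inl i) s (secondQuantization (.fromBlocks (.single j i 1) 0 0 B) m) +
        creation (.inl j) s m := by
  classical
  have isEven : IsEven (Matrix.fromBlocks (.single j i (1 : F)) 0 0 B) := ⟨rfl, rfl⟩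
  rw [(isTwistedDerivation_of_isEven isEven).apply_creation]
  simp [creationLin_apply, Fintype.sum_sum_type, Matrix.one_apply, Matrix.single_apply]

theorem creation_secondQuantization_single_pow (hij : i ≠ j) {s : S}
    (hv : creation (.inl i) s v = 0) (k : ℕ) :
    creation (.inl i) s
        ((secondQuantization (.fromBlocks (.single j i 1) 0 0 B) ^ (k + 1) :
          Module.End F (Fock ι κ S F)) v) =
      -((k + 1 : F) • (secondQuantization (.fromBlocks (.single j i 1) 0 0 B) ^ k :
          Module.End F (Fock ι κ S F)) (creation (.inl j) s v)) := by
  set f : Module.End F (Fock ι κ S F) := secondQuantization (.fromBlocks (.single j i 1) 0 0 B)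
  have creation_f (m) : creation (.inl i) s (f m) = f (creation (.inl i) s m) -
      creation (.inl j) s m := eq_sub_of_add_eq (secondQuantization_single_creation B s m).symm
  have f_creation (k m) : creation (.inl j) s ((f ^ k) m) = (f ^ k) (creation (.inl j) s m) :=
    (LinearMap.congr_fun
      ((commute_secondQuantization_single_creation B hij s).pow_left k) m).symm
  induction k with
  | zero => simp [creation_f, hv]
  | succ k ih =>
    rw [pow_succ', Module.End.mul_apply, creation_f, ih, f_creation, map_neg, map_smul,
      ← Module.End.mul_apply, ← pow_succ', ← neg_add', Nat.cast_succ, add_smul (_ + _) 1, one_smul]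

theorem IsOccupied.secondQuantization_single_pow_ne_zero {p : ℕ} [CharP F p] (hij : i ≠ j)
    (hv : IsOccupied D v) {k : ℕ} (hk : k < p) {T : Finset S}
    (hT : ∀ s ∈ T, (i, s) ∈ D ∧ (j, s) ∉ D) (hkT : k ≤ #T) :
    (secondQuantization (.fromBlocks (.single j i 1) 0 0 B) ^ k : Module.End F (Fock ι κ S F)) v ≠
      0 := by
  induction k generalizing D v T with
  | zero => exact hv.ne_zero
  | succ k ih =>
    intro h
    obtain ⟨s, hs⟩ : T.Nonempty := Finset.card_pos.1 (by omega)
    have := creation_secondQuantization_single_pow B hij (hv.creation i s (hT s hs).1) k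
    rw [h, map_zero, eq_comm, neg_eq_zero, smul_eq_zero] at this
    rcases this with hk0 | hk0
    · rw [← Nat.cast_succ, CharP.cast_eq_zero_iff F p] at hk0
      exact absurd (Nat.le_of_dvd k.succ_pos hk0) (by omega)
    · refine ih (hv.insert (hT s hs).2) (by omega) (T := T.erase s) (fun t ht => ?_) ?_ hk0
      · obtain ⟨hts, ht⟩ := Finset.mem_erase.1 ht
        simp [hT t ht, hts]
      · rw [Finset.card_erase_of_mem hs]
        omega

end Lowering

end Fock

section LoweringMatrices

variable {n : ℕ} {F : Type*} [Field F]

theorem mul_single_one_apply {ι : Type*} [Fintype ι] [DecidableEq ι] (A : Matrix ι ι F)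
    (i j r c : ι) : (A * Matrix.single j i (1 : F)) r c = if i = c then A r j else 0 := by
  simp [Matrix.mul_apply, Matrix.single_apply, ite_and]

theorem single_one_mul_apply {ι : Type*} [Fintype ι] [DecidableEq ι] (A : Matrix ι ι F)
    (i j r c : ι) : (Matrix.single j i (1 : F) * A) r c = if j = r then A i c else 0 := by
  simp [Matrix.mul_apply, Matrix.single_apply, ite_and]

theorem exists_commutator_single_eq {A : Matrix (Fin n) (Fin n) F} (hA : ∀ r c, c ≤ r → A r c = 0)
    {i j : Fin n} (hij : (j : ℕ) = i + 1) :
    ∃ A' : Matrix (Fin n) (Fin n) F, (∀ r c, c ≤ r → A' r c = 0) ∧ A' i j = 0 ∧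
      A * Matrix.single j i (1 : F) - Matrix.single j i (1 : F) * A =
        A' + Matrix.diagonal (Pi.single i (A i j) - Pi.single j (A i j)) := by
  have hne : i ≠ j := by grind
  refine ⟨_, fun r c hrc => ?_, ?_, (sub_add_cancel _ _).symm⟩
  · have hrj : i = c → r ≠ c → A r j = 0 := fun h _ => hA _ _ (by grind)
    have hic : j = r → r ≠ c → A i c = 0 := fun h _ => hA _ _ (by grind)
    simp only [Matrix.sub_apply, mul_single_one_apply, single_one_mul_apply,
      Matrix.diagonal_apply, Pi.sub_apply, Pi.single_apply]
    grind
  · simp only [Matrix.sub_apply, mul_single_one_apply, single_one_mul_apply,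
      Matrix.diagonal_apply]
    simp [hne, hne.symm]

theorem diagonal_commutator_single (d : Fin n → F) (i j : Fin n) :
    Matrix.diagonal d * Matrix.single j i (1 : F) - Matrix.single j i (1 : F) * Matrix.diagonal d =
      (d j - d i) • Matrix.single j i (1 : F) := by
  ext r c
  simp only [Matrix.sub_apply, Matrix.diagonal_mul, Matrix.mul_diagonal, Matrix.smul_apply,
    smul_eq_mul, Matrix.single_apply]
  grind

theorem transpose_mul_single_add {A : Matrix (Fin n) (Fin n) F} (hA : ∀ r c, c ≤ r → A r c = 0)
    {i j : Fin n} (hi : (i : ℕ) + 2 = n) (hj : (j : ℕ) + 1 = n) :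
    A.transpose * Matrix.single i j 1 + Matrix.single i j 1 * A =
      A i j • Matrix.single j j (1 : F) := by
  ext r c
  have hjc : A j c = 0 := hA _ _ (by grind)
  have hir : r ≠ j → A i r = 0 := fun _ => hA _ _ (by grind)
  simp only [Matrix.add_apply, mul_single_one_apply, single_one_mul_apply, Matrix.transpose_apply,
    Matrix.smul_apply, smul_eq_mul, Matrix.single_apply]
  grind

theorem diagonal_mul_single_add (d : Fin n → F) (i j : Fin n) :
    (Matrix.diagonal d).transpose * Matrix.single i j (1 : F) +
      Matrix.single i j 1 * Matrix.diagonal d = (d i + d j) • Matrix.single i j (1 : F) := by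
  ext r c
  simp only [Matrix.add_apply, Matrix.diagonal_transpose, Matrix.diagonal_mul,
    Matrix.mul_diagonal, Matrix.smul_apply, smul_eq_mul, Matrix.single_apply]
  grind

theorem exists_mul_skew_single_eq (B : Matrix (Fin n) (Fin n) F) {i j : Fin n}
    (hi : (i : ℕ) + 2 = n) (hj : (j : ℕ) + 1 = n) :
    ∃ A' : Matrix (Fin n) (Fin n) F, (∀ r c, c ≤ r → A' r c = 0) ∧
      B * (Matrix.single i j 1 - (Matrix.single i j 1).transpose) =
        A' + (Matrix.diagonal (Pi.single j (B j i) - Pi.single i (B i j)) +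
          (-B j j) • Matrix.single j i 1) := by
  refine ⟨_, fun r c hrc => ?_, (sub_add_cancel _ _).symm⟩
  simp only [Matrix.transpose_single, mul_sub, Matrix.sub_apply, mul_single_one_apply,
    Matrix.add_apply, Matrix.smul_apply, Matrix.diagonal_apply, Matrix.single_apply, Pi.sub_apply,
    Pi.single_apply, smul_eq_mul]
  grind

end LoweringMatrices

section Lowering

variable {n : ℕ} {F : Type*} [Field F] {p : ℕ} {M : Type*} [AddCommGroup M] [Module F M]
  [CharP F p]

theorem sum_mul_castPoint_single_sub (a : Fin n → ZMod p) (i j : Fin n) (x y : F) :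
    ∑ m, (Pi.single i x - Pi.single j y : Fin n → F) m * castPoint F a m =
      x * castPoint F a i - y * castPoint F a j := by
  simp [sub_mul, Finset.sum_sub_distrib, Pi.single_apply]

variable [Fact p.Prime]

/-- The lowering operator `e_{ji}` on a module. -/
noncomputable def lowering (Φ : u n F p →ₐ[F] Module.End F M) (i j : Fin n) : Module.End F M :=
  Φ (ιu n F p (aElt (Matrix.single j i 1)))

theorem sum_mul_castPoint_dotWeight_swap {a : Fin n → ZMod p} (d : Fin n → F) {i j : Fin n}
    (hij : (j : ℕ) = i + 1) {k : ℕ} (hk : (k : ZMod p) = a i - a j + 1) :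
    ∑ m, d m * castPoint F (dotWeight (Equiv.swap i j) a) m =
      ∑ m, d m * castPoint F a m + k * (d j - d i) := by
  have hne : i ≠ j := by grind
  have dotWeight_eq : dotWeight (Equiv.swap i j) a =
      a + (Pi.single j (k : ZMod p) - Pi.single i (k : ZMod p)) := by
    funext m
    rcases eq_or_ne m i with rfl | hmi
    · simp [dotWeight, hk, rho, hij, hne]
      ring
    · rcases eq_or_ne m j with rfl | hmj
      · simp [dotWeight, hk, rho, hij, hne.symm]
        ring
      · simp [dotWeight, Equiv.swap_apply_of_ne_of_ne hmi hmj, hmi, hmj]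
  have castPoint_eq (m : Fin n) : castPoint F (dotWeight (Equiv.swap i j) a) m =
      castPoint F a m + (Pi.single j (k : F) - Pi.single i (k : F) : Fin n → F) m := by
    simp [dotWeight_eq, castPoint, Pi.single_apply, apply_ite (ZMod.cast : ZMod p → F)]
  simp only [castPoint_eq, mul_add, Finset.sum_add_distrib, Pi.sub_apply, mul_sub,
    Finset.sum_sub_distrib, Pi.single_apply, mul_ite, mul_zero, Finset.sum_ite_eq',
    Finset.mem_univ, if_true]
  ring

namespace IsSingular

variable {Φ : u n F p →ₐ[F] Module.End F M} {a : Fin n → ZMod p} {v : M} (hv : IsSingular Φ a v)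
include hv

theorem bElt_lowering_pow (i j : Fin n) (k : ℕ) (X) :
    Φ (ιu n F p (bElt X)) ((lowering Φ i j ^ k) v) = 0 := by
  induction k generalizing X with
  | zero => exact hv.degOne X
  | succ k ih =>
    have := DFunLike.congr_fun (map_aElt_mul_bElt Φ (Matrix.single j i 1) X)
      ((lowering Φ i j ^ k) v)
    simp only [Module.End.mul_apply, LinearMap.add_apply, ih, map_zero, add_zero] at this
    rw [pow_succ', Module.End.mul_apply]
    exact this.symm

theorem diagonal_lowering_pow (i j : Fin n) (d : Fin n → F) (k : ℕ) :
    Φ (ιu n F p (aElt (Matrix.diagonal d))) ((lowering Φ i j ^ k) v) =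
      (∑ m, d m * castPoint F a m + k * (d j - d i)) • (lowering Φ i j ^ k) v := by
  induction k with
  | zero => simpa using hv.diag d
  | succ k ih =>
    have := DFunLike.congr_fun (map_aElt_mul_aElt Φ (Matrix.diagonal d) (Matrix.single j i 1))
      ((lowering Φ i j ^ k) v)
    simp only [Module.End.mul_apply, LinearMap.add_apply, diagonal_commutator_single, map_smul,
      LinearMap.smul_apply, ih] at this
    rw [pow_succ', Module.End.mul_apply]
    refine this.trans ((add_smul _ _ _).symm.trans ?_)
    congr 1
    push_cast
    ring

/-- This is the `𝔰𝔩₂` formula `e f^k v = k (⟨μ, α⟩ - k + 1) f^(k-1) v`. -/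
theorem upper_lowering_pow {i j : Fin n} (hij : (j : ℕ) = i + 1) (k : ℕ)
    {A : Matrix (Fin n) (Fin n) F} (hA : ∀ r c, c ≤ r → A r c = 0) :
    Φ (ιu n F p (aElt A)) ((lowering Φ i j ^ k) v) =
      (A i j * (k * (castPoint F a i - castPoint F a j - k + 1))) •
        (lowering Φ i j ^ (k - 1)) v := by
  have hne : i ≠ j := by grind
  induction k generalizing A with
  | zero => simpa using hv.upper A hA
  | succ k ih =>
    obtain ⟨A', hA', hA'0, commutator_eq⟩ := exists_commutator_single_eq hA hij
    have := DFunLike.congr_fun (map_aElt_mul_aElt Φ A (Matrix.single j i 1))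
      ((lowering Φ i j ^ k) v)
    simp only [Module.End.mul_apply, LinearMap.add_apply, commutator_eq, map_add, ih hA', hA'0,
      zero_mul, zero_smul, zero_add, hv.diagonal_lowering_pow, sum_mul_castPoint_single_sub,
      ih hA, map_smul] at this
    have lowering_pow : (k : F) • lowering Φ i j ((lowering Φ i j ^ (k - 1)) v) =
        (k : F) • (lowering Φ i j ^ k) v := by
      rcases Nat.eq_zero_or_pos k with rfl | hk
      · simp
      · rw [← Module.End.mul_apply, ← pow_succ', Nat.sub_add_cancel hk]
    rw [pow_succ', Module.End.mul_apply]
    refine this.trans ?_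
    rw [mul_left_comm, mul_comm, mul_smul, ← lowering, lowering_pow, smul_smul, ← add_smul]
    simp only [Pi.sub_apply, Pi.single_eq_same, Pi.single_eq_of_ne hne, Pi.single_eq_of_ne hne.symm]
    congr 1
    push_cast
    ring

theorem lowering_pow {i j : Fin n} (hij : (j : ℕ) = i + 1) {k : ℕ}
    (hk : (k : ZMod p) = a i - a j + 1) (hne : (lowering Φ i j ^ k) v ≠ 0) :
    IsSingular Φ (dotWeight (Equiv.swap i j) a) ((lowering Φ i j ^ k) v) where
  ne_zero := hne
  upper A hA := by
    have : (k : F) = castPoint F a i - castPoint F a j + 1 := by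
      simpa [castPoint] using congrArg (ZMod.castHom (dvd_refl p) F) hk
    rw [hv.upper_lowering_pow hij k hA, this]
    ring_nf
    simp
  degOne := hv.bElt_lowering_pow i j k
  diag d := by rw [hv.diagonal_lowering_pow, sum_mul_castPoint_dotWeight_swap d hij hk]

section SkewSingle

variable {i j : Fin n}

theorem upper_cElt_single (hi : (i : ℕ) + 2 = n) (hj : (j : ℕ) + 1 = n)
    {A : Matrix (Fin n) (Fin n) F} (hA : ∀ r c, c ≤ r → A r c = 0) :
    Φ (ιu n F p (aElt A)) (Φ (ιu n F p (cElt (Matrix.single i j 1))) v) = 0 := by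
  have cElt_single_self : cElt (Matrix.single j j (1 : F)) = 0 := Subtype.ext (by simp [coe_cElt])
  refine (DFunLike.congr_fun (map_aElt_mul_cElt Φ A (Matrix.single i j 1)) v).trans ?_
  rw [transpose_mul_single_add hA hi hj, map_neg, map_smul, cElt_single_self]
  simp [hv.upper A hA]

theorem bElt_cElt_single (hi : (i : ℕ) + 2 = n) (hj : (j : ℕ) + 1 = n) (haij : a i = a j)
    (hlow : lowering Φ i j v = 0) (X : Matrix (Fin n) (Fin n) F) :
    Φ (ιu n F p (bElt X)) (Φ (ιu n F p (cElt (Matrix.single i j 1))) v) = 0 := by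
  refine (DFunLike.congr_fun (map_bElt_mul_cElt Φ X (Matrix.single i j 1)) v).trans ?_
  obtain ⟨A', hA', mul_eq⟩ := exists_mul_skew_single_eq (X + X.transpose) hi hj
  rw [lowering] at hlow
  have castPoint_eq : castPoint F a i = castPoint F a j := by rw [castPoint, castPoint, haij]
  rw [mul_eq]
  simp only [map_add, map_smul, LinearMap.add_apply, LinearMap.smul_apply, LinearMap.neg_apply,
    Module.End.mul_apply, hv.degOne X, map_zero, neg_zero, hv.upper A' hA', hlow, hv.diag,
    sum_mul_castPoint_single_sub, castPoint_eq, smul_zero, add_zero, zero_add]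
  simp [add_comm]

theorem diagonal_cElt_single (d : Fin n → F) :
    Φ (ιu n F p (aElt (Matrix.diagonal d))) (Φ (ιu n F p (cElt (Matrix.single i j 1))) v) =
      (∑ m, d m * castPoint F (a - Pi.single i 1 - Pi.single j 1) m) •
        Φ (ιu n F p (cElt (Matrix.single i j 1))) v := by
  refine (DFunLike.congr_fun
    (map_aElt_mul_cElt Φ (Matrix.diagonal d) (Matrix.single i j 1)) v).trans ?_
  have castPoint_eq (m : Fin n) : castPoint F (a - Pi.single i 1 - Pi.single j 1) m =
      castPoint F a m - (if m = i then 1 else 0) - (if m = j then 1 else 0) := by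
    simp only [castPoint, Pi.sub_apply, Pi.single_apply, map_sub,
      apply_ite (ZMod.castHom (dvd_refl p) F), map_one, map_zero]
  rw [diagonal_mul_single_add, map_neg, map_smul]
  simp only [LinearMap.add_apply, Module.End.mul_apply, hv.diag, map_smul, map_neg,
    LinearMap.smul_apply, ← neg_smul, ← add_smul, castPoint_eq, mul_sub,
    Finset.sum_sub_distrib, mul_ite, mul_one, mul_zero, Finset.sum_ite_eq', Finset.mem_univ,
    if_true]
  congr 1
  ring

theorem cElt_single (hi : (i : ℕ) + 2 = n) (hj : (j : ℕ) + 1 = n) (haij : a i = a j)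
    (hlow : lowering Φ i j v = 0) (hne : Φ (ιu n F p (cElt (Matrix.single i j 1))) v ≠ 0) :
    IsSingular Φ (a - Pi.single i 1 - Pi.single j 1)
      (Φ (ιu n F p (cElt (Matrix.single i j 1))) v) where
  ne_zero := hne
  upper _ hA := hv.upper_cElt_single hi hj hA
  degOne := hv.bElt_cElt_single hi hj haij hlow
  diag := hv.diagonal_cElt_single

end SkewSingle

end IsSingular

end Lowering

section HighestWeights

open scoped Finset

theorem exists_sum_Ici_eq {n : ℕ} {G : Type*} [AddCommGroup G] (a : Fin n → G) :
    ∃ d : Fin n → G, ∀ i, ∑ j ∈ Finset.Ici i, d j = a i := by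
  let a' (k : ℕ) : G := if h : k < n then a ⟨k, h⟩ else 0
  refine ⟨fun j => a' j - a' (j + 1), fun i => ?_⟩
  calc ∑ j ∈ Finset.Ici i, (a' j - a' (j + 1))
      = ∑ k ∈ Finset.Ico (i : ℕ) n, (a' k - a' (k + 1)) := by
        rw [← Fin.map_valEmbedding_Ici, Finset.sum_map]
        rfl
    _ = a' i - a' n := by
        rw [← neg_inj, ← Finset.sum_neg_distrib, neg_sub, ← Finset.sum_Ico_sub a' i.2.le]
        simp only [neg_sub]
    _ = a i := by simp [a']

variable {n : ℕ} {m : Fin n → ℕ}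

/-- The fermionic modes of a diagram with `m j` columns of height `j + 1`, top-justified. The
corresponding Fock state has the weight with `i`-th coordinate `∑ j ≥ i, m j`. -/
def columns (m : Fin n → ℕ) : Finset (Fin n × Σ j, Fin (m j)) :=
  {x | x.1 ≤ x.2.1}

theorem mem_columns {i : Fin n} {s : Σ j, Fin (m j)} : (i, s) ∈ columns m ↔ i ≤ s.1 := by
  simp [columns]

theorem card_columns (m : Fin n → ℕ) (i : Fin n) :
    #{s | (i, s) ∈ columns m} = ∑ j ∈ Finset.Ici i, m j := by
  have filter_eq : ({s | (i, s) ∈ columns m} : Finset (Σ j, Fin (m j))) =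
      (Finset.Ici i).sigma fun _ => Finset.univ := by
    ext s
    simp [mem_columns]
  simp [filter_eq, Finset.card_sigma]

variable {F : Type*} [Field F] {p : ℕ} [Fact p.Prime] [CharP F p]

theorem isSingular_of_isOccupied {v : Fock (Fin n) (Fin n) (Σ j, Fin (m j)) F}
    (hv : Fock.IsOccupied (columns m) v) {a : Fin n → ZMod p}
    (ha : ∀ i, ((∑ j ∈ Finset.Ici i, m j : ℕ) : ZMod p) = a i) :
    IsSingular (fockAction n _ F p) a v where
  ne_zero := hv.ne_zero
  upper A hA := by
    rw [fockAction_ι, coe_aElt, hv.secondQuantization_fromBlocks]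
    · simp [hA]
    · intro i j s hji hs
      rw [mem_columns] at hs ⊢
      by_contra hjs
      exact hji (hA _ _ (hs.trans (not_le.1 hjs).le))
  degOne X := by
    rw [fockAction_ι, coe_bElt, hv.secondQuantization_fromBlocks] <;> simp
  diag d := by
    rw [fockAction_ι, coe_aElt, hv.secondQuantization_fromBlocks]
    · congr 1
      refine Finset.sum_congr rfl fun i _ => ?_
      rw [Matrix.diagonal_apply_eq, card_columns, castPoint, ← ha, map_natCast]
    · intro i j s hji hs
      rcases eq_or_ne j i with rfl | hne
      · exact hs
      · exact absurd (Matrix.diagonal_apply_ne d hne) hji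

theorem exists_isSingular (a : Fin n → ZMod p) :
    ∃ (m : Fin n → ℕ) (v : _), IsSingular (fockAction n (Σ j, Fin (m j)) F p) a v := by
  obtain ⟨d, hd⟩ := exists_sum_Ici_eq a
  obtain ⟨v, hv⟩ := Fock.exists_isOccupied (Fin n) F (columns fun j => (d j).val)
  exact ⟨_, v, isSingular_of_isOccupied hv fun i => by simp [hd]⟩

theorem exists_isSingular_lowering (a : Fin n → ZMod p) {i j : Fin n} (hij : (j : ℕ) = i + 1)
    {k : ℕ} (hk : k < p) :
    ∃ (m : Fin n → ℕ) (v : _), IsSingular (fockAction n (Σ j, Fin (m j)) F p) a v ∧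
      (lowering (fockAction n (Σ j, Fin (m j)) F p) i j ^ k) v ≠ 0 := by
  obtain ⟨d, hd⟩ := exists_sum_Ici_eq a
  obtain ⟨v, hv⟩ := Fock.exists_isOccupied (Fin n) F (columns fun j => (d j).val + p)
  refine ⟨_, v, isSingular_of_isOccupied hv fun i => by simp [hd], ?_⟩
  rw [lowering, fockAction_ι, coe_aElt]
  refine hv.secondQuantization_single_pow_ne_zero _ (by grind) hk
    (T := ({i} : Finset (Fin n)).sigma fun _ => Finset.univ) (fun s hs => ?_) ?_
  · obtain rfl : s.1 = i := by simpa using hs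
    rw [mem_columns, mem_columns, Fin.le_def, Fin.le_def]
    omega
  · rw [Finset.card_sigma, Finset.sum_singleton, Finset.card_univ, Fintype.card_fin]
    omega

variable {i j : Fin n}

theorem Ici_eq_insert_of_last (hi : (i : ℕ) + 2 = n) (hj : (j : ℕ) + 1 = n) :
    Finset.Ici i = insert i (Finset.Ici j) := by
  ext k
  simp only [Finset.mem_Ici, Finset.mem_insert, Fin.le_def, Fin.ext_iff]
  omega

theorem lowering_eq_zero_of_isOccupied (hi : (i : ℕ) + 2 = n) (hj : (j : ℕ) + 1 = n)
    (hmi : m i = 0) {v : Fock (Fin n) (Fin n) (Σ j, Fin (m j)) F}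
    (hv : Fock.IsOccupied (columns m) v) : lowering (fockAction n _ F p) i j v = 0 := by
  have hij : i ≠ j := by grind
  rw [lowering, fockAction_ι, coe_aElt, hv.secondQuantization_fromBlocks]
  · simp [Matrix.single_apply, hij, ite_and]
  · intro r c s hcr hrs
    obtain ⟨rfl, rfl⟩ : j = c ∧ i = r := by
      by_contra h
      exact hcr (Matrix.single_apply_of_ne _ _ _ _ _ h)
    have hsi : s.1 ≠ i := fun h => s.2.pos.ne' (by rw [h, hmi])
    rw [mem_columns] at hrs ⊢
    grind

theorem exists_isSingular_cElt {a : Fin n → ZMod p} (hi : (i : ℕ) + 2 = n)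
    (hj : (j : ℕ) + 1 = n) (haij : a i = a j) :
    ∃ (m : Fin n → ℕ) (v : _), IsSingular (fockAction n (Σ j, Fin (m j)) F p) a v ∧
      IsSingular (fockAction n (Σ j, Fin (m j)) F p) (a - Pi.single i 1 - Pi.single j 1)
        (fockAction n (Σ j, Fin (m j)) F p (ιu n F p (cElt (Matrix.single i j 1))) v) := by
  have hij : i ≠ j := by grind
  obtain ⟨d, hd⟩ := exists_sum_Ici_eq a
  have hdi : d i = 0 := by
    have := hd i
    rwa [Ici_eq_insert_of_last hi hj, Finset.sum_insert (by grind), hd, haij,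
      add_eq_right] at this
  let m (k : Fin n) : ℕ := (d k).val + if k = j then p else 0
  have hp : 0 < m j := by simp [m, (Fact.out : p.Prime).pos]
  obtain ⟨v, hv⟩ := Fock.exists_isOccupied (Fin n) F (columns m)
  have hs : IsSingular (fockAction n _ F p) a v :=
    isSingular_of_isOccupied hv fun i => by simp [m, apply_ite, hd]
  refine ⟨m, v, hs, hs.cElt_single hi hj haij
    (lowering_eq_zero_of_isOccupied hi hj (by simp [m, hdi, hij]) hv) ?_⟩
  rw [fockAction_ι, coe_cElt]
  refine hv.secondQuantization_lower_ne_zero (j := j) (k := i) (s := ⟨j, 0, hp⟩)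
    (mem_columns.2 le_rfl) ?_
  simp [hij]

end HighestWeights

/-! ### The centre -/

section Centre

variable {n : ℕ} {F : Type*} [Field F] {p : ℕ} [Fact p.Prime] [CharP F p]

theorem commute_ι_of_mem_Z {z : ubar n F p} (hz : z ∈ Z n F p) {x : pn n F} (hx : x ∈ odd n F) :
    Commute z (ι n F p x) :=
  ((Subalgebra.mem_centralizer_iff F).1 hz.2 _ ⟨x, hx, rfl⟩).symm

theorem ι_aElt_single_eq (hp : p ≠ 2) {i j : Fin n} (hij : i ≠ j) :
    ι n F p (aElt (Matrix.single j i 1)) =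
      ι n F p (cElt (Matrix.single j i 1)) * ι n F p (bElt (Matrix.single j j 2⁻¹)) +
        ι n F p (bElt (Matrix.single j j 2⁻¹)) * ι n F p (cElt (Matrix.single j i 1)) := by
  have two_ne : (2 : F) ≠ 0 := two_ne_zero_of_char hp
  have mul_eq : (Matrix.single j j (2⁻¹ : F) + (Matrix.single j j (2⁻¹ : F)).transpose) *
      (Matrix.single j i 1 - (Matrix.single j i 1).transpose) = Matrix.single j i 1 := by
    rw [Matrix.transpose_single, Matrix.transpose_single, ← Matrix.single_add, ← two_mul,
      mul_inv_cancel₀ two_ne]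
    simp [mul_sub, hij.symm]
  have := map_bElt_mul_cElt (mkubar n F p) (Matrix.single j j 2⁻¹) (Matrix.single j i 1)
  rw [mul_eq] at this
  exact (neg_add_eq_iff_eq_add.1 this.symm)

theorem commute_ι_aElt_single_of_mem_Z (hp : p ≠ 2) {z : ubar n F p} (hz : z ∈ Z n F p)
    {i j : Fin n} (hij : i ≠ j) : Commute z (ι n F p (aElt (Matrix.single j i 1))) := by
  have hb := commute_ι_of_mem_Z hz (bElt_mem_degOne (Matrix.single j j (2⁻¹ : F))).1
  have hc := commute_ι_of_mem_Z hz (cElt_mem_odd (Matrix.single j i (1 : F)))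
  rw [ι_aElt_single_eq hp hij]
  exact (hc.mul_right hb).add_right (hb.mul_right hc)

theorem nilAction_ι_pow {M : Type*} [AddCommGroup M] [Module F M]
    (Φ : u n F p →ₐ[F] Module.End F M) (x : pn n F) (k : ℕ) (m : nilPart Φ) :
    (nilAction Φ (ι n F p x ^ k) m : M) = (Φ (ιu n F p x) ^ k) m := by
  induction k with
  | zero => simp
  | succ k ih =>
    rw [pow_succ', pow_succ', map_mul, Module.End.mul_apply, nilAction_ι, ih, Module.End.mul_apply]

theorem IsSingular.evalUh_eq_of_commute {M : Type*} [AddCommGroup M] [Module F M]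
    {Φ : u n F p →ₐ[F] Module.End F M} (hp : p ≠ 2) {a b : Fin n → ZMod p} {v : M} {x : pn n F}
    {k : ℕ} (hv : IsSingular Φ a v) (hw : IsSingular Φ b ((Φ (ιu n F p x) ^ k) v))
    {z : ubar n F p} {f : uh n F p} (hz : z - uhToUbar n F p f ∈ lIdeal n F p)
    (hzx : Commute z (ι n F p x)) : evalUh F a f = evalUh F b f := by
  have hv' := hv.mem_nilPart hp
  have hw' := hw.mem_nilPart hp
  have nilAction_pow : nilAction Φ (ι n F p x ^ k) ⟨v, hv'⟩ = ⟨(Φ (ιu n F p x) ^ k) v, hw'⟩ :=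
    Subtype.ext (nilAction_ι_pow Φ x k _)
  have eval_smul_eq : evalUh F a f • (Φ (ιu n F p x) ^ k) v =
      evalUh F b f • (Φ (ιu n F p x) ^ k) v := by
    refine congrArg Subtype.val (a₁ := evalUh F a f • (⟨_, hw'⟩ : nilPart Φ))
      (a₂ := evalUh F b f • ⟨_, hw'⟩) ?_
    rw [← hw.nilAction_of_sub_mem hp hw' hz, ← nilAction_pow, ← map_smul,
      ← hv.nilAction_of_sub_mem hp hv' hz, ← Module.End.mul_apply, ← Module.End.mul_apply,
      ← map_mul, ← map_mul, (hzx.pow_right k).eq]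
  exact smul_left_injective F hw.ne_zero eval_smul_eq

theorem eq_zero_of_uhToUbar_mem_lIdeal (hp : p ≠ 2) {f : uh n F p}
    (h : uhToUbar n F p f ∈ lIdeal n F p) : f = 0 := by
  refine uh_ext fun a => ?_
  obtain ⟨m, v, hv⟩ := exists_isSingular (F := F) a
  have hv' := hv.mem_nilPart hp
  have eval_smul_eq : evalUh F a f • (⟨v, hv'⟩ : nilPart _) = 0 := by
    rw [← hv.nilAction_uhToUbar, hv.nilAction_lIdeal hp hv' h]
  simpa using (smul_eq_zero.1 (congrArg Subtype.val eval_smul_eq)).resolve_right hv.ne_zero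

theorem dotWeight_one {K : Type*} [Field K] (a : Fin n → K) : dotWeight 1 a = a := by
  funext i
  simp [dotWeight]

theorem dotWeight_mul {K : Type*} [Field K] (w w' : Equiv.Perm (Fin n)) (a : Fin n → K) :
    dotWeight (w * w') a = dotWeight w (dotWeight w' a) := by
  funext i
  simp [dotWeight]

variable {z : ubar n F p} {f : uh n F p}

theorem evalUh_dotWeight_swap (hp : p ≠ 2) (hz : z ∈ Z n F p)
    (hf : z - uhToUbar n F p f ∈ lIdeal n F p) {i j : Fin n} (hij : (j : ℕ) = i + 1)
    (a : Fin n → ZMod p) : evalUh F (dotWeight (Equiv.swap i j) a) f = evalUh F a f := by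
  obtain ⟨m, v, hv, hne⟩ := exists_isSingular_lowering (F := F) a hij (ZMod.val_lt (a i - a j + 1))
  exact (hv.evalUh_eq_of_commute hp (hv.lowering_pow hij (by simp) hne) hf
    (commute_ι_aElt_single_of_mem_Z hp hz (by grind))).symm

theorem evalUh_dotWeight (hp : p ≠ 2) (hz : z ∈ Z n F p)
    (hf : z - uhToUbar n F p f ∈ lIdeal n F p) (w : Equiv.Perm (Fin n)) (a : Fin n → ZMod p) :
    evalUh F (dotWeight w a) f = evalUh F a f := by
  rcases n with _ | n
  · rw [Subsingleton.elim (dotWeight w a) a]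
  have hw : w ∈ Submonoid.closure
      (Set.range fun i : Fin n => Equiv.swap i.castSucc i.succ) := by
    rw [Equiv.Perm.mclosure_swap_castSucc_succ]
    trivial
  induction hw using Submonoid.closure_induction generalizing a with
  | mem w hw =>
    obtain ⟨i, rfl⟩ := hw
    exact evalUh_dotWeight_swap hp hz hf (by simp) a
  | one => rw [dotWeight_one]
  | mul w w' _ _ ih ih' => rw [dotWeight_mul, ih, ih']

theorem evalUh_pairShift_sub_rho (hp : p ≠ 2) (hz : z ∈ Z n F p)
    (hf : z - uhToUbar n F p f ∈ lIdeal n F p) {i j : Fin n} (hi : (i : ℕ) + 2 = n)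
    (hj : (j : ℕ) + 1 = n) {l : Fin n → ZMod p} (hl : l i = l j + 1) :
    evalUh F (pairShift i j 1 l - rho) f = evalUh F (l - rho) f := by
  have hij : i ≠ j := by grind
  have rho_eq : (rho i : ZMod p) = rho j + 1 := by
    simp [rho, show (j : ℕ) = i + 1 by omega]
  have apply_eq : (pairShift i j 1 l - rho : Fin n → ZMod p) i =
      (pairShift i j 1 l - rho : Fin n → ZMod p) j := by
    simp [pairShift, hij, hij.symm, hl, rho_eq]
  have sub_eq : l - rho = pairShift i j 1 l - rho - Pi.single i 1 - Pi.single j 1 := by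
    rw [pairShift]
    abel
  obtain ⟨m, v, hv, hw⟩ := exists_isSingular_cElt (F := F) hi hj apply_eq
  rw [sub_eq]
  exact hv.evalUh_eq_of_commute hp (k := 1) (by rwa [pow_one]) hf
    (commute_ι_of_mem_Z hz (cElt_mem_odd _))

theorem exists_eq_theta_mul_add_of_mem_hcZ (hp : p ≠ 2) (hf : f ∈ hcZ n F p) :
    ∃ q ∈ uhInv n F p, ∃ c : F, f = theta n F p * q + algebraMap F (uh n F p) c := by
  obtain ⟨z, hz, -, hf⟩ := hf
  have hW := evalUh_dotWeight hp hz hf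
  refine exists_eq_theta_mul_add hW fun a b ha hb => ?_
  obtain ⟨i, j, hij, ha⟩ := exists_of_evalUh_theta_eq_zero ha
  obtain ⟨i', j', hij', hb⟩ := exists_of_evalUh_theta_eq_zero hb
  obtain ⟨i₀, j₀, hi₀, hj₀⟩ : ∃ i₀ j₀ : Fin n, (i₀ : ℕ) + 2 = n ∧ (j₀ : ℕ) + 1 = n :=
    ⟨⟨n - 2, by grind⟩, ⟨n - 1, by grind⟩, by grind, by grind⟩
  have symm (w : Equiv.Perm (Fin n)) (l : Fin n → ZMod p) :
      evalUh F (l ∘ w - rho) f = evalUh F (l - rho) f := by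
    rw [← hW w⁻¹ (l - rho)]
    congr 2
    funext k
    simp [dotWeight]
  have shift (l : Fin n → ZMod p) (hl : l i₀ = l j₀ + 1) :
      evalUh F (pairShift i₀ j₀ 1 l - rho) f = evalUh F (l - rho) f :=
    evalUh_pairShift_sub_rho hp hz hf hi₀ hj₀ hl
  have eval_eq := eq_of_symmetric_of_pairShift hp (G := fun l => evalUh F (l - rho) f) symm
    (by grind) shift (l := a + rho) (l' := b + rho) hij ha hij' hb
  simpa only [add_sub_cancel_right] using eval_eq

end Centre

/-! ### The triangular decomposition -/

section OneParameter

variable {F E : Type*} [Field F] [AddCommGroup E] [Module F E]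

/-- The vectors on which the operators `T t` act with weight `k`, that is, by the scalars `t ^ k`;
here `t ↦ T t` is thought of as the action of a one-dimensional torus. -/
def weightSpace (T : Fˣ → Module.End F E) (k : ℕ) : Submodule F E :=
  ⨅ t, (T t).eigenspace ((t : F) ^ k)

theorem mem_weightSpace {T : Fˣ → Module.End F E} {k : ℕ} {x : E} :
    x ∈ weightSpace T k ↔ ∀ t, T t x = (t : F) ^ k • x := by
  simp [weightSpace]

theorem exists_unit_pow_succ_ne_one (F : Type*) [Field F] [Infinite F] (s : Finset ℕ) :
    ∃ t : Fˣ, ∀ k ∈ s, (t : F) ^ (k + 1) ≠ 1 := by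
  have ne_zero : (Polynomial.X * ∏ k ∈ s, (Polynomial.X ^ (k + 1) - 1) : Polynomial F) ≠ 0 :=
    mul_ne_zero Polynomial.X_ne_zero
      (Finset.prod_ne_zero_iff.2 fun k _ => Polynomial.X_pow_sub_C_ne_zero k.succ_pos 1)
  obtain ⟨t, ht⟩ : ∃ t : F, ¬ Polynomial.eval t _ = 0 := by
    by_contra! h
    exact ne_zero (Polynomial.funext fun t => by rw [h, Polynomial.eval_zero])
  rw [Polynomial.eval_mul, Polynomial.eval_prod, Polynomial.eval_X, mul_eq_zero, not_or] at ht
  refine ⟨Units.mk0 t ht.1, fun k hk => ?_⟩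
  simpa [sub_eq_zero] using Finset.prod_ne_zero_iff.1 ht.2 k hk

theorem mem_of_fixed_of_mem_iSup_weightSpace_sup [Infinite F] {T : Fˣ → Module.End F E}
    {L : Submodule F E} (hL : ∀ t, L ≤ L.comap (T t)) {x : E} (fixed : ∀ t, T t x = x)
    (hx : x ∈ (⨆ k, weightSpace T (k + 1)) ⊔ L) : x ∈ L := by
  obtain ⟨w, hw, l, hl, rfl⟩ := Submodule.mem_sup.1 hx
  obtain ⟨s, hw⟩ := (Submodule.mem_iSup_iff_exists_finset).1 hw
  obtain ⟨t, ht⟩ := exists_unit_pow_succ_ne_one F s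
  have mk_add : L.mkQ (w + l) = L.mkQ w := by
    rw [map_add, L.mkQ_apply l, (Submodule.Quotient.mk_eq_zero L).2 hl, add_zero]
  let T' : Module.End F (E ⧸ L) := L.mapQ L (T t) (hL t)
  have mem_one : L.mkQ (w + l) ∈ T'.eigenspace 1 := by
    rw [Module.End.mem_eigenspace_iff, Submodule.mkQ_apply, Submodule.mapQ_apply, fixed, one_smul]
  have mem_iSup : L.mkQ (w + l) ∈ ⨆ c ≠ 1, T'.eigenspace c := by
    have weightSpace_le : ⨆ k ∈ s, weightSpace T (k + 1) ≤
        (⨆ c ≠ 1, T'.eigenspace c).comap L.mkQ := by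
      refine iSup₂_le fun k hk y hy => ?_
      refine Submodule.mem_iSup_of_mem _ (Submodule.mem_iSup_of_mem (ht k hk) ?_)
      rw [Module.End.mem_eigenspace_iff, Submodule.mkQ_apply, Submodule.mapQ_apply,
        mem_weightSpace.1 hy, Submodule.Quotient.mk_smul]
    rw [mk_add]
    exact weightSpace_le hw
  have eq_zero := Submodule.disjoint_def.1 (T'.eigenspaces_iSupIndep 1) _ mem_one mem_iSup
  rwa [Submodule.mkQ_apply, Submodule.Quotient.mk_eq_zero] at eq_zero

end OneParameter

theorem apply_mem_of_forall_single {m n R M : Type*} [Finite m] [Finite n] [DecidableEq m]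
    [DecidableEq n] [Semiring R] [AddCommMonoid M] [Module R M] {K : Submodule R M}
    (f : Matrix m n R →ₗ[R] M) (A : Matrix m n R)
    (h : ∀ i j, A i j ≠ 0 → f (Matrix.single i j 1) ∈ K) : f A ∈ K := by
  cases nonempty_fintype m
  cases nonempty_fintype n
  rw [Matrix.matrix_eq_sum_single A]
  simp only [map_sum]
  refine sum_mem fun i _ => sum_mem fun j _ => ?_
  by_cases hA : A i j = 0
  · rw [hA, Matrix.single_zero, map_zero]
    exact K.zero_mem
  · rw [← mul_one (A i j), ← smul_eq_mul, ← Matrix.smul_single, map_smul]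
    exact K.smul_mem _ (h i j hA)

theorem mul_mem_of_mem_adjoin {R A : Type*} [CommSemiring R] [Semiring A] [Algebra R A]
    {s : Set A} {V : Submodule R A} (h : ∀ x ∈ s, ∀ v ∈ V, x * v ∈ V) {a v : A}
    (ha : a ∈ Algebra.adjoin R s) (hv : v ∈ V) : a * v ∈ V := by
  induction ha using Algebra.adjoin_induction generalizing v with
  | mem x hx => exact h x hx v hv
  | algebraMap r => rw [← Algebra.smul_def]; exact V.smul_mem r hv
  | add x y _ _ hx hy => rw [add_mul]; exact V.add_mem (hx hv) (hy hv)
  | mul x y _ _ hx hy => rw [mul_assoc]; exact hx (hy hv)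

section Torus

variable {n : ℕ} {F : Type*} [Field F]

theorem Ad_aElt (g : GL (Fin n) F) (A : Matrix (Fin n) (Fin n) F) :
    Ad g (aElt A) = aElt (g.val * A * g.inv) :=
  Subtype.ext <| (conj_fromBlocks g A 0 0 (-A.transpose)).trans <| by
    simp [coe_aElt, Matrix.transpose_mul, mul_assoc]

theorem Ad_cElt (g : GL (Fin n) F) (Y : Matrix (Fin n) (Fin n) F) :
    Ad g (cElt Y) = cElt (g.inv.transpose * Y * g.inv) :=
  Subtype.ext <| (conj_fromBlocks g 0 0 (Y - Y.transpose) 0).trans <| by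
    simp [coe_cElt, Matrix.transpose_mul, mul_assoc, mul_sub, sub_mul]

theorem Ad_torus_aElt_single (s : Fin n → Fˣ) (i j : Fin n) :
    Ad (torus s) (aElt (Matrix.single i j 1)) =
      (s i * (s j)⁻¹ : F) • aElt (Matrix.single i j 1) := by
  rw [Ad_aElt, ← map_smul]
  congr 1
  ext a b
  simp only [torus, Units.val_inv_eq_inv_val, Units.inv_eq_val_inv, Units.inv_mk,
    Matrix.mul_diagonal, Matrix.diagonal_mul, Matrix.single_apply, mul_ite, mul_one, mul_zero,
    ite_mul, zero_mul, Matrix.smul_apply, smul_eq_mul]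
  grind

theorem Ad_torus_cElt_single (s : Fin n → Fˣ) (i j : Fin n) :
    Ad (torus s) (cElt (Matrix.single i j 1)) =
      ((s i)⁻¹ * (s j)⁻¹ : F) • cElt (Matrix.single i j 1) := by
  rw [Ad_cElt, ← map_smul]
  congr 1
  ext a b
  simp only [torus, Units.val_inv_eq_inv_val, Units.inv_eq_val_inv, Units.inv_mk,
    Matrix.diagonal_transpose, Matrix.mul_diagonal, Matrix.diagonal_mul, Matrix.single_apply,
    mul_ite, mul_one, mul_zero, ite_mul, zero_mul, Matrix.smul_apply, smul_eq_mul]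
  grind

theorem Ad_torus_hElt (s : Fin n → Fˣ) (i : Fin n) : Ad (torus s) (hElt F i) = hElt F i := by
  rw [hElt_eq_aElt, Matrix.diagonal_single, Ad_torus_aElt_single, Units.mul_inv, one_smul]

theorem Ad_torus_mem_nPlus (s : Fin n → Fˣ) {x : pn n F} (hx : x ∈ nPlus n F) :
    Ad (torus s) x ∈ nPlus n F := by
  obtain ⟨x, hx'⟩ := x
  obtain ⟨A, B, C, D, rfl⟩ : ∃ A B C D, x = .fromBlocks A B C D :=
    ⟨_, _, _, _, (Matrix.fromBlocks_toBlocks x).symm⟩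
  obtain ⟨rfl, hA⟩ : C = 0 ∧ ∀ i j, j ≤ i → A i j = 0 := hx
  have Ad_eq := conj_fromBlocks (torus s) A B 0 D
  refine ⟨(congrArg Matrix.toBlocks₂₁ Ad_eq).trans (by simp), fun i j hij => ?_⟩
  exact (congrFun (congrFun Ad_eq _) _).trans (by simp [torus, hA i j hij])

/-- A one-parameter subgroup of the torus with positive weights on the opposite of `𝔫⁺`. -/
def torusOne (n : ℕ) (t : Fˣ) : GL (Fin n) F :=
  torus fun i => (t ^ (n - (i : ℕ)))⁻¹

theorem Ad_torusOne_aElt_single (t : Fˣ) {i j : Fin n} (hij : i < j) :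
    Ad (torusOne n t) (aElt (Matrix.single j i 1)) =
      (t : F) ^ ((j : ℕ) - i) • aElt (Matrix.single j i 1) := by
  rw [torusOne, Ad_torus_aElt_single]
  congr 1
  simp only [Units.val_inv_eq_inv_val, inv_inv, Units.val_pow_eq_pow_val]
  rw [inv_mul_eq_iff_eq_mul₀ (by simp), ← pow_add]
  congr 1
  omega

theorem Ad_torusOne_cElt_single (t : Fˣ) (i j : Fin n) :
    Ad (torusOne n t) (cElt (Matrix.single i j 1)) =
      (t : F) ^ (n - i + (n - j) : ℕ) • cElt (Matrix.single i j 1) := by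
  rw [torusOne, Ad_torus_cElt_single]
  simp [pow_add]

end Torus

section Triangular

variable {n : ℕ} {F : Type*} [Field F]

/-- The standard generators of the subalgebra of `𝔤` opposite to `𝔫⁺`, which consists of the
matrices with `b = 0` and `a` lower triangular. -/
inductive IsLowerGenerator : pn n F → Prop
  | hElt (i : Fin n) : IsLowerGenerator (hElt F i)
  | aElt {i j : Fin n} (hij : i < j) : IsLowerGenerator (aElt (Matrix.single j i 1))
  | cElt (i j : Fin n) : IsLowerGenerator (cElt (Matrix.single i j 1))

theorem IsLowerGenerator.mem_even_or_mem_odd {y : pn n F} (hy : IsLowerGenerator y) :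
    y ∈ even n F ∨ y ∈ odd n F := by
  cases hy with
  | hElt i => exact .inl (hElt_even F i)
  | aElt _ => exact .inl (aElt_mem_even _)
  | cElt i j => exact .inr (cElt_mem_odd _)

theorem aElt_single_mem_nPlus {i j : Fin n} (hij : i < j) :
    aElt (Matrix.single i j 1) ∈ nPlus n F := by
  refine ⟨rfl, fun k l hlk => ?_⟩
  simp only [coe_aElt, Matrix.transpose_single, Matrix.fromBlocks_apply₁₁, Matrix.single_apply,
    ite_eq_right_iff, one_ne_zero, imp_false, not_and]
  grind

theorem bElt_mem_nPlus (X : Matrix (Fin n) (Fin n) F) : bElt X ∈ nPlus n F :=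
  ⟨rfl, fun _ _ _ => rfl⟩

variable {p : ℕ} [Fact p.Prime] [CharP F p]

theorem span_isLowerGenerator_sup_nPlus (hp : p ≠ 2) :
    Submodule.span F {y : pn n F | IsLowerGenerator y} ⊔ nPlus n F = ⊤ := by
  refine eq_top_iff.2 fun x _ => ?_
  obtain ⟨A, X, Y, rfl⟩ := exists_eq_aElt_add_bElt_add_cElt hp x
  have lower_mem {y : pn n F} (hy : IsLowerGenerator y) :
      y ∈ Submodule.span F {y : pn n F | IsLowerGenerator y} ⊔ nPlus n F :=
    Submodule.mem_sup_left (Submodule.subset_span hy)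
  refine add_mem (add_mem ?_ (Submodule.mem_sup_right (bElt_mem_nPlus X))) ?_
  · refine apply_mem_of_forall_single aElt A fun i j _ => ?_
    rcases lt_trichotomy i j with hij | rfl | hij
    · exact Submodule.mem_sup_right (aElt_single_mem_nPlus hij)
    · rw [← Matrix.diagonal_single, ← hElt_eq_aElt]
      exact lower_mem (.hElt i)
    · exact lower_mem (.aElt hij)
  · exact apply_mem_of_forall_single cElt Y fun i j _ => lower_mem (.cElt i j)

variable (n F p) in
/-- The left ideal `ū 𝔫⁺`. -/
noncomputable def upperIdeal : Ideal (ubar n F p) :=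
  Ideal.span (ι n F p '' (nPlus n F : Set (pn n F)))

variable (n F p) in
/-- The image in `ū` of the enveloping algebra of the subalgebra opposite to `𝔫⁺`. -/
noncomputable def lowerAlgebra : Subalgebra F (ubar n F p) :=
  Algebra.adjoin F (ι n F p '' {y | IsLowerGenerator y})

theorem exists_ι_mul_ι_eq {x y : pn n F} (hx : x ∈ even n F ∨ x ∈ odd n F)
    (hy : y ∈ even n F ∨ y ∈ odd n F) :
    ∃ (c : F) (z : pn n F), ι n F p x * ι n F p y = c • (ι n F p y * ι n F p x) + ι n F p z := by
  rcases hx with hx | hx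
  · refine ⟨1, ⟨_, comm_mem x y hx hy⟩, ?_⟩
    rw [one_smul]
    exact map_ιu_comm (mkubar n F p) hx hy rfl
  rcases hy with hy | hy
  · refine ⟨1, -⟨_, comm_mem y x hy (.inr hx)⟩, ?_⟩
    rw [one_smul, map_neg, ← sub_eq_add_neg, eq_sub_iff_add_eq]
    exact (map_ιu_comm (mkubar n F p) hy (.inr hx) rfl).symm
  · refine ⟨-1, ⟨_, anticomm_mem x y hx hy⟩, ?_⟩
    rw [neg_one_smul]
    exact map_ιu_anticomm (mkubar n F p) hx hy rfl

variable (n F p) in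
/-- The subspace spanned by the subalgebra of the opposite of `𝔫⁺` and by `ū 𝔫⁺`; it is all of
`ū`. -/
noncomputable def lowerSupUpper : Submodule F (ubar n F p) :=
  Subalgebra.toSubmodule (lowerAlgebra n F p) ⊔ (upperIdeal n F p).restrictScalars F

theorem ι_mem_upperIdeal {x : pn n F} (hx : x ∈ nPlus n F) : ι n F p x ∈ upperIdeal n F p :=
  Ideal.subset_span ⟨x, hx, rfl⟩

theorem ι_mem_lowerAlgebra {y : pn n F} (hy : IsLowerGenerator y) :
    ι n F p y ∈ lowerAlgebra n F p :=
  Algebra.subset_adjoin ⟨y, hy, rfl⟩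

theorem ι_mem_lowerSupUpper (hp : p ≠ 2) (x : pn n F) : ι n F p x ∈ lowerSupUpper n F p := by
  have hx : x ∈ Submodule.span F {y : pn n F | IsLowerGenerator y} ⊔ nPlus n F :=
    span_isLowerGenerator_sup_nPlus (F := F) hp ▸ Submodule.mem_top
  have sup_le : Submodule.span F {y : pn n F | IsLowerGenerator y} ⊔ nPlus n F ≤
      (lowerSupUpper n F p).comap (ι n F p) :=
    sup_le (Submodule.span_le.2 fun _ hy => Submodule.mem_sup_left (ι_mem_lowerAlgebra hy))
      fun _ hx => Submodule.mem_sup_right (ι_mem_upperIdeal hx)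
  exact sup_le hx

theorem lowerAlgebra_mul_mem_lowerSupUpper {b v : ubar n F p} (hb : b ∈ lowerAlgebra n F p)
    (hv : v ∈ lowerSupUpper n F p) : b * v ∈ lowerSupUpper n F p := by
  obtain ⟨b', hb', l, hl, rfl⟩ := Submodule.mem_sup.1 hv
  rw [mul_add]
  exact Submodule.add_mem_sup ((lowerAlgebra n F p).mul_mem hb hb')
    ((upperIdeal n F p).mul_mem_left b hl)

theorem ι_mul_mem_lowerSupUpper (hp : p ≠ 2) {b : ubar n F p} (hb : b ∈ lowerAlgebra n F p)
    (x : pn n F) : ι n F p x * b ∈ lowerSupUpper n F p := by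
  let V : Submodule F (ubar n F p) :=
    ⨅ x, (lowerSupUpper n F p).comap (LinearMap.mulLeft F (ι n F p x))
  have mem_V {b : ubar n F p} : b ∈ V ↔ ∀ x, ι n F p x * b ∈ lowerSupUpper n F p := by simp [V]
  have ι_mul_mem : ∀ y ∈ ι n F p '' {y | IsLowerGenerator y}, ∀ b ∈ V, y * b ∈ V := by
    rintro _ ⟨y, hy, rfl⟩ b hb
    rw [mem_V] at hb ⊢
    have of_homogeneous {x : pn n F} (hx : x ∈ even n F ∨ x ∈ odd n F) :
        ι n F p x * (ι n F p y * b) ∈ lowerSupUpper n F p := by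
      obtain ⟨c, z, h⟩ := exists_ι_mul_ι_eq (p := p) hx hy.mem_even_or_mem_odd
      rw [← mul_assoc, h, add_mul, smul_mul_assoc, mul_assoc]
      exact add_mem (Submodule.smul_mem _ c
        (lowerAlgebra_mul_mem_lowerSupUpper (ι_mem_lowerAlgebra hy) (hb x))) (hb z)
    intro x
    obtain ⟨A, X, Y, rfl⟩ := exists_eq_aElt_add_bElt_add_cElt hp x
    rw [map_add, map_add, add_mul, add_mul]
    exact add_mem (add_mem (of_homogeneous (.inl (aElt_mem_even A)))
      (of_homogeneous (.inr (bElt_mem_degOne X).1))) (of_homogeneous (.inr (cElt_mem_odd Y)))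
  have one_mem : 1 ∈ V := mem_V.2 fun x => by rw [mul_one]; exact ι_mem_lowerSupUpper hp x
  have := mul_mem_of_mem_adjoin ι_mul_mem hb one_mem
  rw [mul_one] at this
  exact mem_V.1 this x

theorem adjoin_range_ι : Algebra.adjoin F (Set.range (ι n F p)) = ⊤ := by
  refine Algebra.eq_top_iff.2 fun a => ?_
  induction a using ubar_induction with
  | algebraMap r => exact Subalgebra.algebraMap_mem _ r
  | ι x => exact Algebra.subset_adjoin ⟨x, rfl⟩
  | mul a b ha hb => exact mul_mem ha hb
  | add a b ha hb => exact add_mem ha hb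

theorem lowerSupUpper_eq_top (hp : p ≠ 2) : lowerSupUpper n F p = ⊤ := by
  refine eq_top_iff.2 fun a _ => ?_
  have ι_mul_mem : ∀ x ∈ Set.range (ι n F p), ∀ v ∈ lowerSupUpper n F p,
      x * v ∈ lowerSupUpper n F p := by
    rintro _ ⟨x, rfl⟩ v hv
    obtain ⟨b, hb, l, hl, rfl⟩ := Submodule.mem_sup.1 hv
    rw [mul_add]
    exact add_mem (ι_mul_mem_lowerSupUpper hp hb x)
      (Submodule.mem_sup_right ((upperIdeal n F p).mul_mem_left _ hl))
  have one_mem : 1 ∈ lowerSupUpper n F p := Submodule.mem_sup_left (one_mem (lowerAlgebra n F p))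
  rw [← mul_one a]
  exact mul_mem_of_mem_adjoin ι_mul_mem (adjoin_range_ι (F := F) ▸ Algebra.mem_top) one_mem

section Weights

variable (n F p) in
/-- The subspace of `ū` of weight `k` for the one-parameter subgroup `torusOne`. -/
noncomputable def ubarWeightSpace (k : ℕ) : Submodule F (ubar n F p) :=
  weightSpace (fun t => (act p (torusOne n t)).toLinearMap) k

theorem mem_ubarWeightSpace {k : ℕ} {a : ubar n F p} :
    a ∈ ubarWeightSpace n F p k ↔ ∀ t : Fˣ, act p (torusOne n t) a = (t : F) ^ k • a :=
  mem_weightSpace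

theorem mul_mem_ubarWeightSpace {k l : ℕ} {a b : ubar n F p} (ha : a ∈ ubarWeightSpace n F p k)
    (hb : b ∈ ubarWeightSpace n F p l) : a * b ∈ ubarWeightSpace n F p (k + l) := by
  rw [mem_ubarWeightSpace] at *
  intro t
  rw [map_mul, ha, hb, smul_mul_smul_comm, pow_add]

theorem mul_mem_iSup_ubarWeightSpace {k : ℕ} {a b : ubar n F p}
    (ha : a ∈ ubarWeightSpace n F p k) (hb : b ∈ ⨆ l, ubarWeightSpace n F p (l + 1)) :
    a * b ∈ ⨆ l, ubarWeightSpace n F p (l + 1) := by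
  suffices ⨆ l, ubarWeightSpace n F p (l + 1) ≤
      (⨆ l, ubarWeightSpace n F p (l + 1)).comap (LinearMap.mulLeft F a) from this hb
  refine iSup_le fun l b hb => Submodule.mem_iSup_of_mem (k + l) ?_
  rw [add_assoc]
  exact mul_mem_ubarWeightSpace ha hb

theorem act_torus_polyToUbar (s : Fin n → Fˣ) (q : MvPolynomial (Fin n) F) :
    act p (torus s) (polyToUbar n F p q) = polyToUbar n F p q := by
  refine AlgHom.congr_fun (φ₁ := (act p (torus s)).comp (polyToUbar n F p)) ?_ q
  ext i
  rw [AlgHom.comp_apply, polyToUbar_X, act_ι, Ad_torus_hElt]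

theorem polyToUbar_mem_ubarWeightSpace (q : MvPolynomial (Fin n) F) :
    polyToUbar n F p q ∈ ubarWeightSpace n F p 0 :=
  mem_ubarWeightSpace.2 fun t => by rw [torusOne, act_torus_polyToUbar, pow_zero, one_smul]

theorem IsLowerGenerator.eq_hElt_or_ι_mem {y : pn n F} (hy : IsLowerGenerator y) :
    (∃ i, y = Periplectic.hElt F i) ∨ ∃ k, ι n F p y ∈ ubarWeightSpace n F p (k + 1) := by
  cases hy with
  | hElt i => exact .inl ⟨i, rfl⟩
  | @aElt i j hij =>
    refine .inr ⟨(j : ℕ) - i - 1, mem_ubarWeightSpace.2 fun t => ?_⟩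
    rw [act_ι, Ad_torusOne_aElt_single t hij, map_smul, Nat.sub_add_cancel (by omega)]
  | cElt i j =>
    refine .inr ⟨n - i + (n - j) - 1, mem_ubarWeightSpace.2 fun t => ?_⟩
    rw [act_ι, Ad_torusOne_cElt_single, map_smul, Nat.sub_add_cancel (by omega)]

theorem lowerAlgebra_le : Subalgebra.toSubmodule (lowerAlgebra n F p) ≤
    (polyToUbar n F p).range.toSubmodule ⊔ ⨆ k, ubarWeightSpace n F p (k + 1) := by
  intro b hb
  have ι_mul_mem : ∀ y ∈ ι n F p '' {y | IsLowerGenerator y},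
      ∀ v ∈ (polyToUbar n F p).range.toSubmodule ⊔ ⨆ k, ubarWeightSpace n F p (k + 1),
        y * v ∈ (polyToUbar n F p).range.toSubmodule ⊔ ⨆ k, ubarWeightSpace n F p (k + 1) := by
    rintro _ ⟨y, hy, rfl⟩ v hv
    obtain ⟨_, ⟨q, rfl⟩, w, hw, rfl⟩ := Submodule.mem_sup.1 hv
    rw [mul_add]
    obtain ⟨i, rfl⟩ | ⟨k, hk⟩ := hy.eq_hElt_or_ι_mem (p := p)
    · rw [← polyToUbar_X]
      exact Submodule.add_mem_sup ⟨MvPolynomial.X i * q, map_mul _ _ _⟩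
        (mul_mem_iSup_ubarWeightSpace (polyToUbar_mem_ubarWeightSpace _) hw)
    · have mul_q := mul_mem_ubarWeightSpace hk (polyToUbar_mem_ubarWeightSpace q)
      rw [add_zero] at mul_q
      exact Submodule.mem_sup_right (add_mem (Submodule.mem_iSup_of_mem k mul_q)
        (mul_mem_iSup_ubarWeightSpace hk hw))
  rw [← mul_one b]
  exact mul_mem_of_mem_adjoin ι_mul_mem hb
    (Submodule.mem_sup_left (one_mem (polyToUbar n F p).range))

theorem act_torus_mem_upperIdeal (s : Fin n → Fˣ) {a : ubar n F p} (ha : a ∈ upperIdeal n F p) :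
    act p (torus s) a ∈ upperIdeal n F p := by
  induction ha using Submodule.span_induction with
  | mem _ hx =>
    obtain ⟨x, hx, rfl⟩ := hx
    rw [act_ι]
    exact ι_mem_upperIdeal (Ad_torus_mem_nPlus s hx)
  | zero => rw [map_zero]; exact zero_mem _
  | add a b _ _ ha hb => rw [map_add]; exact add_mem ha hb
  | smul r a _ ha => rw [smul_eq_mul, map_mul]; exact Ideal.mul_mem_left _ _ ha

theorem act_torus_of_mem_ubarT {v : ubar n F p} (hv : v ∈ ubarT n F p) (s : Fin n → Fˣ) :
    act p (torus s) v = v :=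
  Algebra.mem_iInf.1 hv s

end Weights

theorem exists_isHCImage [Infinite F] (hp : p ≠ 2) {v : ubar n F p} (hv : v ∈ ubarT n F p) :
    ∃ f, IsHCImage p v f := by
  have mem_top : v ∈ lowerSupUpper n F p := lowerSupUpper_eq_top (F := F) hp ▸ Submodule.mem_top
  obtain ⟨b, hb, l, hl, hbl⟩ := Submodule.mem_sup.1 mem_top
  obtain ⟨_, ⟨q, rfl⟩, w, hw, rfl⟩ := Submodule.mem_sup.1 (lowerAlgebra_le hb)
  have sub_eq : v - polyToUbar n F p q = w + l := by
    rw [← hbl, add_assoc]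
    exact add_sub_cancel_left _ _
  have sub_mem_ubarT : v - polyToUbar n F p q ∈ ubarT n F p :=
    sub_mem hv (Algebra.mem_iInf.2 fun s => act_torus_polyToUbar s q)
  refine ⟨Ideal.Quotient.mk _ q, hv, ?_, sub_mem_ubarT⟩
  refine mem_of_fixed_of_mem_iSup_weightSpace_sup
    (T := fun t => (act p (torusOne n t)).toLinearMap)
    (fun _ _ ha => act_torus_mem_upperIdeal _ ha)
    (fun _ => act_torus_of_mem_ubarT sub_mem_ubarT _) ?_
  exact sub_eq ▸ Submodule.add_mem_sup hw hl

end Triangular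

end Periplectic

theorem theorem3p14_general (n : ℕ) (F : Type*) [Field F] [Infinite F]
    (p : ℕ) [Fact p.Prime] [CharP F p] (hp : p ≠ 2) :
    (∀ v ∈ Periplectic.ubarT n F p, ∃! f : Periplectic.uh n F p, Periplectic.IsHCImage p v f) ∧
    Periplectic.hcZ n F p ⊆
      {f | ∃ q ∈ Periplectic.uhInv n F p, ∃ c : F,
        f = Periplectic.theta n F p * q + algebraMap F (Periplectic.uh n F p) c} := by
  refine ⟨fun v hv => ?_, fun f hf => Periplectic.exists_eq_theta_mul_add_of_mem_hcZ hp hf⟩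
  obtain ⟨f, hf⟩ := Periplectic.exists_isHCImage hp hv
  refine ⟨f, hf, fun g hg => ?_⟩
  have sub_mem_lIdeal := sub_mem hf.2 hg.2
  rw [sub_sub_sub_cancel_left, ← map_sub] at sub_mem_lIdeal
  exact sub_eq_zero.1 (Periplectic.eq_zero_of_uhToUbar_mem_lIdeal hp sub_mem_lIdeal)

/-- The first conjunct says that the Harish-Chandra projection is well defined, that is
`ū^T = u(𝔥) ⊕ 𝔩`; the second one is the inclusion `h(𝒵) ⊆ Θ u(𝔥)^{W·} + F`. -/
theorem theorem3p14 (n : ℕ) (hn : 2 ≤ n) (F : Type*) [Field F] [IsAlgClosed F]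
    (p : ℕ) [Fact p.Prime] [CharP F p] (hp3 : 3 < p) (hp : n * (n - 1) < p) :
    (∀ v ∈ Periplectic.ubarT n F p, ∃! f : Periplectic.uh n F p, Periplectic.IsHCImage p v f) ∧
    Periplectic.hcZ n F p ⊆
      {f | ∃ q ∈ Periplectic.uhInv n F p, ∃ c : F,
        f = Periplectic.theta n F p * q + algebraMap F (Periplectic.uh n F p) c} := by
  have : Infinite F := IsAlgClosed.instInfinite
  exact theorem3p14_general n F p (by omega)
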